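/- Let $p$ be $0$ or a prime and let $\mathbf{k}$ be a field of characteristic $p$. *Matroids.* Let $F$ be any field of characteristic $p$. Vectors $v_1,\dots,v_n\in F^r$ are *totally generic* if their $nr$ coordinates are algebraically independent over the prime field of $F$. For totally generic $v_1,\dots,v_n\in F^r$, the symmetric power matroid $\mathrm{S}_n(r,p)$ is the matroid on $\{(i,j): 1\le i\le j\le n\}$ represented by the vectors $v_iv_j\in\operatorname{Sym}^2F^r$, and the wedge power matroid $\mathrm{W}_n(r,p)$ is the matroid on $\{(i,j): 1\le i<j\le n\}$ represented by the vectors $v_i\wedge v_j\in\wedge^2F^r$. For $u_1,\dots,u_m\in F^s$ and $v_1,\dots,v_n\in F^r$ whose $ms+nr$ coordinates are together algebraically independent over the prime field, the tensor matroid $\mathrm{T}_{m,n}(s,r,p)$ is the matroid on $[m]\times[n]$ represented by the vectors $u_i\otimes v_j\in F^s\otimes F^r$. (The statements below hold for every choice of $F$ and of such vectors.) *Varieties.* For a set $Y$ of $m\times n$ matrices over an algebraic closure $\overline{\mathbf{k}}$, let $I(Y)\subseteq\mathbf{k}[x_{ij}]$ be the ideal of polynomials vanishing on $Y$. If $I(Y)$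 is prime, the function field of $Y$ over $\mathbf{k}$ is $K(Y)=\operatorname{Frac}(\mathbf{k}[x_{ij}]/I(Y))$, and the coordinate functions on $Y$ are the images of the $x_{ij}$ in $K(Y)$. A matrix is called skew-symmetric if $A^t=-A$ and its diagonal is zero. *Separable independence.* For a finitely generated field extension $K/L$, elements $a_1,\dots,a_\ell\in K$ are *separably algebraically independent* over $L$ if there are $b_1,\dots,b_q\in K$ such that $a_1,\dots,a_\ell,b_1,\dots,b_q$ are algebraically independent over $L$ and $K$ is a finite separable extension of $L(a_1,\dots,a_\ell,b_1,\dots,b_q)$. Then the following hold. 1. Suppose $p\ne2$ and $0\le d\le n$, and let $Y$ be the variety of symmetric $n\times n$ matrices of rank at most $d$. Then $I(Y)$ is prime, and a set $S\subseteq\{(i,j): i\le j\}$ is independent in the dual of $\mathrm{S}_n(n-d,p)$ if and only if the coordinate functions $(x_{ij})_{(i,j)\in S}$ in $K(Y)$ are separably algebraically independent over $\mathbf{k}$. 2. Suppose $0\le 2d\le n$, and let $Y$ be the variety of skew-symmetric $n\times n$ matrices of rank at most $2d$. Then $I(Y)$ is prime, and a set $S\subseteq\{(i,j): i<j\}$ is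 independent in the dual of $\mathrm{W}_n(n-2d,p)$ if and only if the coordinate functions $(x_{ij})_{(i,j)\in S}$ in $K(Y)$ are separably algebraically independent over $\mathbf{k}$. 3. Suppose $0\le d\le\min(m,n)$, and let $Y$ be the variety of $m\times n$ matrices of rank at most $d$. Then $I(Y)$ is prime, and a set $S\subseteq[m]\times[n]$ is independent in the dual of $\mathrm{T}_{m,n}(m-d,n-d,p)$ if and only if the coordinate functions $(x_{ij})_{(i,j)\in S}$ in $K(Y)$ are separably algebraically independent over $\mathbf{k}$. -/

import Mathlib

open scoped TensorProduct

namespace LowRank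

/-! ### Matroids represented by finite families of vectors -/

/-- The augmentation axiom for linearly independent subfamilies of a finite family. -/
theorem linearIndepOn_augment {F V α : Type*} [Field F] [AddCommGroup V] [Module F V] [Finite α]
    (v : α → V) {I J : Set α} (hI : LinearIndepOn F v I) (hJ : LinearIndepOn F v J)
    (hlt : I.ncard < J.ncard) : ∃ e ∈ J, e ∉ I ∧ LinearIndepOn F v (insert e I) := by
  classical
  by_contra! hcon
  have hmem : ∀ e ∈ J, v e ∈ Submodule.span F (v '' I) := by
    intro e he
    by_cases heI : e ∈ I
    · exact Submodule.subset_span ⟨e, heI, rfl⟩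
    · by_contra hne
      exact hcon e he heI ((linearIndepOn_insert heI).2 ⟨hI, hne⟩)
  have hle : Submodule.span F (v '' J) ≤ Submodule.span F (v '' I) := by
    rw [Submodule.span_le]
    rintro _ ⟨e, he, rfl⟩
    exact hmem e he
  have hcard : ∀ X : Set α, LinearIndepOn F v X →
      Module.finrank F (Submodule.span F (v '' X)) = X.ncard := by
    intro X hX
    have := Fintype.ofFinite X
    have h := finrank_span_eq_card (R := F) (b := fun x : X => v x) hX
    rw [Set.image_eq_range, h, ← Nat.card_eq_fintype_card, Nat.card_coe_set_eq]
  have : Module.Finite F (Submodule.span F (v '' I)) :=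
    FiniteDimensional.span_of_finite F (Set.toFinite _)
  have := Submodule.finrank_mono hle
  rw [hcard I hI, hcard J hJ] at this
  omega

/-- The matroid represented by a finite family of vectors: its ground set is the whole index type,
and a set of indices is independent when the corresponding subfamily is linearly independent. -/
noncomputable def representedMatroid (F : Type*) {V α : Type*} [Field F] [AddCommGroup V]
    [Module F V] [Finite α] (v : α → V) : Matroid α :=
  (IndepMatroid.ofFinite (E := Set.univ) Set.finite_univ (fun I => LinearIndepOn F v I)
    (linearIndepOn_empty F v) (fun _ _ hJ hIJ => hJ.mono hIJ)
    (fun _ _ hI hJ hlt => linearIndepOn_augment v hI hJ hlt)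
    (fun _ _ => Set.subset_univ _)).matroid

/-! ### Symmetric power, wedge power and tensor matroids -/

/-- The set `binom([n], 2) ⊔ [n]`, encoded as the pairs `i ≤ j`. -/
abbrev SymIndex (n : ℕ) : Type := {e : Fin n × Fin n // e.1 ≤ e.2}

/-- The set `binom([n], 2)`, encoded as the pairs `i < j`. -/
abbrev SkewIndex (n : ℕ) : Type := {e : Fin n × Fin n // e.1 < e.2}

/-- A family of scalars of `F` is generic when it is algebraically independent over the prime
field of `F`. -/
def GenericScalars {F ι : Type*} [Field F] (c : ι → F) : Prop :=
  AlgebraicIndependent (⊥ : Subfield F) c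

/-- Vectors `v₁, …, vₙ` of `F ^ r` are totally generic when their `n * r` coordinates are
algebraically independent over the prime field. -/
def TotallyGeneric {F : Type*} [Field F] {n r : ℕ} (v : Fin n → Fin r → F) : Prop :=
  GenericScalars fun e : Fin n × Fin r => v e.1 e.2

/-- Vectors `u₁, …, uₘ` of `F ^ s` and `v₁, …, vₙ` of `F ^ r` are jointly totally generic when all
their `m * s + n * r` coordinates together are algebraically independent over the prime field. -/
def JointlyTotallyGeneric {F : Type*} [Field F] {m n s r : ℕ}
    (u : Fin m → Fin s → F) (v : Fin n → Fin r → F) : Prop :=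
  GenericScalars (Sum.elim (fun e : Fin m × Fin s => u e.1 e.2)
    (fun e : Fin n × Fin r => v e.1 e.2))

/-- The matroid represented by the products `vᵢ vⱼ`, `i ≤ j`, in `Sym² (F ^ r)`, the degree-two
part of the symmetric algebra of `F ^ r`. For totally generic `v` over a field of characteristic
`p` this is the symmetric power matroid `S_n(r, p)`. -/
noncomputable def symmetricPowerMatroid {F : Type*} [Field F] {n r : ℕ} (v : Fin n → Fin r → F) :
    Matroid (SymIndex n) :=
  representedMatroid F fun e : SymIndex n =>
    SymmetricAlgebra.ι F (Fin r → F) (v e.1.1) * SymmetricAlgebra.ι F (Fin r → F) (v e.1.2)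

/-- The matroid represented by the products `vᵢ ∧ vⱼ`, `i < j`, in `⋀² (F ^ r)`. For totally
generic `v` over a field of characteristic `p` this is the wedge power matroid `W_n(r, p)`. -/
noncomputable def wedgePowerMatroid {F : Type*} [Field F] {n r : ℕ} (v : Fin n → Fin r → F) :
    Matroid (SkewIndex n) :=
  representedMatroid F fun e : SkewIndex n => exteriorPower.ιMulti F 2 ![v e.1.1, v e.1.2]

/-- The matroid represented by the tensors `uᵢ ⊗ vⱼ` in `F ^ s ⊗ F ^ r`. For jointly totally
generic `u`, `v` over a field of characteristic `p` this is the tensor matroid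
`T_{m,n}(s, r, p)`. -/
noncomputable def tensorMatroid {F : Type*} [Field F] {m n s r : ℕ}
    (u : Fin m → Fin s → F) (v : Fin n → Fin r → F) : Matroid (Fin m × Fin n) :=
  representedMatroid F fun e : Fin m × Fin n => u e.1 ⊗ₜ[F] v e.2

/-! ### Varieties of matrices and their function fields -/

/-- The `m × n` matrices of rank at most `d`. -/
def rankLocus (R : Type*) [Field R] (m n d : ℕ) : Set (Matrix (Fin m) (Fin n) R) :=
  {A | A.rank ≤ d}

/-- The symmetric `n × n` matrices of rank at most `d`. -/
def symRankLocus (R : Type*) [Field R] (n d : ℕ) : Set (Matrix (Fin n) (Fin n) R) :=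
  {A | A.IsSymm ∧ A.rank ≤ d}

/-- The skew-symmetric `n × n` matrices of rank at most `d`. The diagonal is required to vanish,
which is automatic outside characteristic two. -/
def skewRankLocus (R : Type*) [Field R] (n d : ℕ) : Set (Matrix (Fin n) (Fin n) R) :=
  {A | A.transpose = -A ∧ (∀ i, A i i = 0) ∧ A.rank ≤ d}

/-- The ideal over `k` of a set `Y` of matrices with entries in the algebraic closure of `k`: the
polynomials over `k` in the matrix entries that vanish on `Y`. -/
noncomputable def matrixIdeal (k : Type*) [Field k] {m n : ℕ}
    (Y : Set (Matrix (Fin m) (Fin n) (AlgebraicClosure k))) :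
    Ideal (MvPolynomial (Fin m × Fin n) k) :=
  MvPolynomial.vanishingIdeal k ((fun A (e : Fin m × Fin n) => A e.1 e.2) '' Y)

/-- The ring of regular functions, over `k`, on a variety of matrices. -/
abbrev CoordinateRing (k : Type*) [Field k] {m n : ℕ}
    (Y : Set (Matrix (Fin m) (Fin n) (AlgebraicClosure k))) : Type _ :=
  MvPolynomial (Fin m × Fin n) k ⧸ matrixIdeal k Y

/-- The ring of rational functions, over `k`, on a variety of matrices. It is a field when the
ideal of the variety is prime. -/
abbrev FunctionField (k : Type*) [Field k] {m n : ℕ}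
    (Y : Set (Matrix (Fin m) (Fin n) (AlgebraicClosure k))) : Type _ :=
  FractionRing (CoordinateRing k Y)

/-- The coordinate function `A ↦ A i j`, as a rational function on a variety of matrices. -/
noncomputable def coordinateFunction (k : Type*) [Field k] {m n : ℕ}
    (Y : Set (Matrix (Fin m) (Fin n) (AlgebraicClosure k))) (e : Fin m × Fin n) :
    FunctionField k Y :=
  algebraMap (CoordinateRing k Y) (FunctionField k Y)
    (Ideal.Quotient.mk (matrixIdeal k Y) (MvPolynomial.X e))

/-! ### Separable algebraic independence -/

/-- A separating transcendence basis of `K / L`: an algebraically independent family such that `K`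
is a finite separable extension of the subfield it generates over `L`. -/
def IsSeparatingTranscendenceBasis (L : Type*) {K ι : Type*} [Field L] [Field K] [Algebra L K]
    (c : ι → K) : Prop :=
  AlgebraicIndependent L c ∧
    FiniteDimensional (IntermediateField.adjoin L (Set.range c)) K ∧
    Algebra.IsSeparable (IntermediateField.adjoin L (Set.range c)) K

/-- A family is separably algebraically independent when it can be extended by finitely many
elements to a separating transcendence basis. -/
def SeparablyAlgebraicallyIndependent (L : Type*) {K ι : Type*} [Field L] [Field K] [Algebra L K]
    (a : ι → K) : Prop :=
  ∃ (q : ℕ) (b : Fin q → K), IsSeparatingTranscendenceBasis L (Sum.elim a b)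

end LowRank

/-!
The variety of matrices of rank at most `d` is parametrized by `X C Yᵀ`, where the frames `X` and
`Y` have an identity block on top and all the other entries of `X`, `C` and `Y` are free. These
entries can be recovered rationally from the product, so the ideal of the variety is the kernel of a
map to a polynomial ring, hence prime, and its function field is purely transcendental.

Rational functions are separably independent exactly when their differentials are linearly
independent. The relations among the differentials of the matrix entries are the conormal vectors at
the generic point, the matrices `N` with `Xᵀ N = 0` and `N Y = 0`. These are the products
`U B Vᵀ`, where the columns of the coframes `U` and `V` span the orthogonal complements of the
columns of `X` and `Y`, so that `S` is separably independent when no nonzero `U B Vᵀ` is supported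
on `S`.

On the other side, a functional on the space of a represented matroid is a bilinear form `B`, and
`S` is independent in the dual exactly when no nonzero `U B Vᵀ` is supported on `S`, the rows of `U`
and `V` now being the generic vectors. A change of basis brings these into coframe form, and generic
vectors over two fields of the same characteristic satisfy the same integral polynomial relations.

The symmetric and skew-symmetric cases take `Y = X`, with `C` and `B` of the same symmetry type.
In the symmetric case the off-diagonal entries of a conormal vector are twice those of `U B Uᵀ`,
which is harmless outside characteristic two.
-/

namespace LowRank

open scoped Matrix Kronecker

/-! ### Separable algebraic independence and differentials -/

section Differentials

open KaehlerDifferential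

variable {k L : Type*} [Field k] [Field L] [Algebra k L]

theorem D_mem_span_of_mem_adjoin {s : Set L} {x : L} (hx : x ∈ IntermediateField.adjoin k s) :
    D k L x ∈ Submodule.span L (D k L '' s) := by
  induction hx using IntermediateField.adjoin_induction with
  | mem x hx => exact Submodule.subset_span ⟨x, hx, rfl⟩
  | algebraMap x => simp
  | add x y _ _ hx hy => rw [map_add]; exact add_mem hx hy
  | inv x _ hx => rw [Derivation.leibniz_inv]; exact Submodule.smul_mem _ _ hx
  | mul x y _ _ hx hy =>
    rw [Derivation.leibniz]
    exact add_mem (Submodule.smul_mem _ _ hy) (Submodule.smul_mem _ _ hx)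

theorem range_mapBaseChange_adjoin (s : Set L) :
    LinearMap.range (mapBaseChange k (IntermediateField.adjoin k s) L) =
      Submodule.span L (D k L '' s) := by
  apply le_antisymm
  · rintro _ ⟨z, rfl⟩
    induction z with
    | zero => simp
    | add x y hx hy => rw [map_add]; exact add_mem hx hy
    | tmul x ω =>
      rw [mapBaseChange_tmul]
      refine Submodule.smul_mem _ _ ?_
      have hω : ω ∈ Submodule.span _ (Set.range (D k (IntermediateField.adjoin k s))) :=
        span_range_derivation k (IntermediateField.adjoin k s) ▸ Submodule.mem_top
      induction hω using Submodule.span_induction with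
      | mem _ h =>
        obtain ⟨a, rfl⟩ := h
        rw [map_D]
        exact D_mem_span_of_mem_adjoin a.2
      | zero => simp
      | add _ _ _ _ h₁ h₂ => rw [map_add]; exact add_mem h₁ h₂
      | smul a _ _ h => rw [map_smul, ← algebraMap_smul L]; exact Submodule.smul_mem _ _ h
  · rw [Submodule.span_le]
    rintro _ ⟨x, hx, rfl⟩
    refine ⟨1 ⊗ₜ D k _ ⟨x, IntermediateField.subset_adjoin k s hx⟩, ?_⟩
    rw [mapBaseChange_tmul, map_D, one_smul]
    rfl

theorem span_D_eq_top_iff_formallyUnramified (s : Set L) :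
    Submodule.span L (D k L '' s) = ⊤ ↔
      Algebra.FormallyUnramified (IntermediateField.adjoin k s) L := by
  rw [Algebra.formallyUnramified_iff, ← range_mapBaseChange_adjoin, range_mapBaseChange,
    LinearMap.ker_eq_top]
  constructor
  · intro h
    refine subsingleton_of_forall_eq 0 fun ω => ?_
    obtain ⟨η, rfl⟩ := map_surjective k (IntermediateField.adjoin k s) L ω
    rw [h, LinearMap.zero_apply]
  · exact fun _ => Subsingleton.elim _ _

theorem IsSeparatingTranscendenceBasis.card_eq_trdeg {ι : Type*} [Finite ι] {c : ι → L}
    (h : IsSeparatingTranscendenceBasis k c) : (Nat.card ι : Cardinal) = Algebra.trdeg k L := by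
  obtain ⟨hindep, hfinite, -⟩ := h
  have halg : Algebra.IsAlgebraic (Algebra.adjoin k (Set.range c)) L :=
    IntermediateField.isAlgebraic_adjoin_iff_top.mp (Algebra.IsAlgebraic.of_finite _ _)
  have := (hindep.isTranscendenceBasis_iff_isAlgebraic.2 halg).lift_cardinalMk_eq_trdeg
  rw [← Nat.cast_card (α := ι), Cardinal.lift_natCast] at this
  exact Cardinal.lift_injective (by rw [← this, Cardinal.lift_natCast])

theorem isSeparatingTranscendenceBasis_iff_span_D_eq_top {ι : Type*} [Finite ι]
    [Algebra.EssFiniteType k L] {c : ι → L} (hc : (Nat.card ι : Cardinal) = Algebra.trdeg k L) :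
    IsSeparatingTranscendenceBasis k c ↔
      Submodule.span L (Set.range fun i => D k L (c i)) = ⊤ := by
  have : Algebra.EssFiniteType (IntermediateField.adjoin k (Set.range c)) L :=
    Algebra.EssFiniteType.of_comp k _ L
  rw [Set.range_comp' (D k L), span_D_eq_top_iff_formallyUnramified]
  constructor
  · rintro ⟨-, -, _⟩
    exact Algebra.FormallyUnramified.of_isSeparable _ _
  · intro h
    have hfinite := Algebra.FormallyUnramified.finite_of_free
      (R := IntermediateField.adjoin k (Set.range c)) (S := L)
    refine ⟨?_, hfinite, Algebra.FormallyUnramified.isSeparable _ _⟩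
    have halg : Algebra.IsAlgebraic (Algebra.adjoin k (Set.range c)) L :=
      IntermediateField.isAlgebraic_adjoin_iff_top.mp (Algebra.IsAlgebraic.of_finite _ _)
    refine (Algebra.IsAlgebraic.isTranscendenceBasis_of_lift_le_trdeg_of_finite k c ?_).1
    rw [← hc, Cardinal.lift_natCast, ← Nat.cast_card (α := ι), Cardinal.lift_natCast]

theorem isSeparatingTranscendenceBasis_iff_linearIndependent_and_span_D {ι : Type*} [Finite ι]
    [Algebra.EssFiniteType k L] (hL : (Module.finrank L Ω[L⁄k] : Cardinal) = Algebra.trdeg k L)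
    {c : ι → L} :
    IsSeparatingTranscendenceBasis k c ↔ LinearIndependent L (fun i => D k L (c i)) ∧
      Submodule.span L (Set.range fun i => D k L (c i)) = ⊤ := by
  have := Fintype.ofFinite ι
  constructor
  · intro h
    have hspan := (isSeparatingTranscendenceBasis_iff_span_D_eq_top h.card_eq_trdeg).1 h
    refine ⟨linearIndependent_of_top_le_span_of_card_eq_finrank hspan.ge ?_, hspan⟩
    rw [← Nat.card_eq_fintype_card]
    exact_mod_cast h.card_eq_trdeg.trans hL.symm
  · rintro ⟨hindep, hspan⟩
    refine (isSeparatingTranscendenceBasis_iff_span_D_eq_top ?_).2 hspan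
    rw [← hL, Module.finrank_eq_card_basis (.mk hindep hspan.ge), Nat.card_eq_fintype_card]

theorem exists_sumElim_linearIndependent_and_span {K V X ι : Type*} [DivisionRing K]
    [AddCommGroup V] [Module K V] [FiniteDimensional K V] {g : X → V}
    (hg : Submodule.span K (Set.range g) = ⊤) {a : ι → X}
    (ha : LinearIndependent K fun i => g (a i)) :
    ∃ (q : ℕ) (b : Fin q → X), LinearIndependent K (fun i => g (Sum.elim a b i)) ∧
      Submodule.span K (Set.range fun i => g (Sum.elim a b i)) = ⊤ := by
  have ha_inj : Function.Injective a := fun i j hij => ha.injective (congrArg g hij)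
  have hon : LinearIndepOn K g (Set.range a) := (linearIndepOn_range_iff ha_inj g).2 ha
  set E := hon.extend (Set.subset_univ _)
  have hE : LinearIndepOn K g E := hon.linearIndepOn_extend (Set.subset_univ _)
  have hsub : Set.range a ⊆ E := hon.subset_extend (Set.subset_univ _)
  have hspan : Submodule.span K (g '' E) = ⊤ := by
    rw [hon.span_image_extend_eq_span_image, Set.image_univ, hg]
  have : Finite E := hE.finite
  obtain ⟨q, ⟨e⟩⟩ := Finite.exists_equiv_fin (E \ Set.range a : Set X)
  let b : Fin q → X := fun i => (e.symm i).1
  have hb : Set.range b = E \ Set.range a :=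
    (e.symm.surjective.range_comp Subtype.val).trans Subtype.range_coe
  have hrange : Set.range (Sum.elim a b) = E := by
    rw [Set.Sum.elim_range, hb, Set.union_sdiff_cancel hsub]
  refine ⟨q, b, ?_, by rw [Set.range_comp', hrange, hspan]⟩
  refine (linearIndepOn_range_iff ?_ g).1 (hrange ▸ hE)
  refine ha_inj.sumElim (Subtype.val_injective.comp e.symm.injective) fun i j hij => ?_
  exact (hb ▸ Set.mem_range_self j : b j ∈ E \ Set.range a).2 ⟨i, hij⟩

theorem separablyAlgebraicallyIndependent_iff_linearIndependent_D {ι : Type*} [Finite ι]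
    [Algebra.EssFiniteType k L] (hL : (Module.finrank L Ω[L⁄k] : Cardinal) = Algebra.trdeg k L)
    {a : ι → L} :
    SeparablyAlgebraicallyIndependent k a ↔ LinearIndependent L fun i => D k L (a i) := by
  simp only [SeparablyAlgebraicallyIndependent,
    isSeparatingTranscendenceBasis_iff_linearIndependent_and_span_D hL]
  constructor
  · rintro ⟨q, b, h, -⟩
    exact h.comp Sum.inl Sum.inl_injective
  · exact exists_sumElim_linearIndependent_and_span (span_range_derivation k L)

end Differentials

/-! ### Subsets that contain no support -/

/-- `ContainsNoSupport S W`: the only function in `W` whose support is contained in `S` is zero.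
Both kinds of independence in the theorem take this form, with `W` the conormal space of the
variety at its generic point, respectively the space of all `e ↦ g (v e)` for linear functionals `g`
and the vectors `v e` that represent the matroid. -/
def ContainsNoSupport {E R : Type*} [Zero R] (S : Set E) (W : Set (E → R)) : Prop :=
  ∀ c ∈ W, (∀ e ∉ S, c e = 0) → c = 0

theorem containsNoSupport_iff_of_mul_mem_iff {E R : Type*} [MulZeroClass R] [NoZeroDivisors R]
    {S : Set E} {W W' : Set (E → R)} {a : E → R} (ha : ∀ e, a e ≠ 0)
    (hmem : ∀ c, c ∈ W ↔ a * c ∈ W') (hdvd : ∀ c ∈ W', ∃ c', c = a * c') :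
    ContainsNoSupport S W ↔ ContainsNoSupport S W' := by
  have hmul (c : E → R) (e : E) : (a * c) e = 0 ↔ c e = 0 := by simp [ha]
  constructor
  · intro h c hc hS
    obtain ⟨c, rfl⟩ := hdvd c hc
    simp only [hmul] at hS
    rw [h c ((hmem c).2 hc) hS, mul_zero]
  · intro h c hc hS
    have := h (a * c) ((hmem c).1 hc) fun e he => (hmul c e).2 (hS e he)
    exact funext fun e => (hmul c e).1 (congrFun this e)

theorem linearIndepOn_iff_containsNoSupport {R M E : Type*} [Ring R] [AddCommGroup M]
    [Module R M] [Fintype E] {v : E → M} {S : Set E} :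
    LinearIndepOn R v S ↔ ContainsNoSupport S {c : E → R | ∑ e, c e • v e = 0} := by
  rw [linearIndepOn_iff]
  refine Finsupp.equivFunOnFinite.forall_congr fun {l} => ?_
  rw [Finsupp.mem_supported', Finsupp.linearCombination_apply,
    Finsupp.sum_fintype l (fun i a => a • v i) fun _ => zero_smul R _, ← Finsupp.coe_eq_zero]
  exact forall_comm

/-! ### Purely transcendental extensions -/

section FractionField

open MvPolynomial

variable {k L T : Type*} [Field k] [Field L] [Algebra k L] [Algebra (MvPolynomial T k) L]
  [IsScalarTower k (MvPolynomial T k) L]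

theorem mkDerivation_eq_sum_pderiv [Fintype T] (w : T → L) (g : MvPolynomial T k) :
    mkDerivation k w g = ∑ t, algebraMap _ L (pderiv t g) * w t := by
  induction g using MvPolynomial.induction_on with
  | C a => simp
  | add p q hp hq => simp only [map_add, hp, hq, add_mul, Finset.sum_add_distrib]
  | mul_X p i hp =>
    classical
    simp [Derivation.leibniz, hp, add_mul, Finset.sum_add_distrib, Pi.single_apply,
      Algebra.smul_def, Finset.mul_sum, mul_assoc, apply_ite (algebraMap (MvPolynomial T k) L)]

variable (L) in
/-- The conormal space, at the point `algebraMap ∘ f` over `L`, of the variety parametrized by the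
polynomials `f e`: the linear forms that vanish on all the tangent vectors obtained by
differentiating `f` in a direction `w`. -/
def conormalSpace {E : Type*} [Fintype E] (f : E → MvPolynomial T k) : Set (E → L) :=
  {c | ∀ w : T → L, ∑ e, c e * mkDerivation k w (f e) = 0}

variable [IsFractionRing (MvPolynomial T k) L]

variable (k L T) in
theorem essFiniteType_of_isFractionRing_mvPolynomial [Finite T] : Algebra.EssFiniteType k L :=
  have : Algebra.EssFiniteType (MvPolynomial T k) L :=
    Algebra.EssFiniteType.of_isLocalization L (nonZeroDivisors (MvPolynomial T k))
  Algebra.EssFiniteType.comp k (MvPolynomial T k) L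

variable (k L T) in
/-- The differentials of the variables, as a basis of the differentials of the field of rational
functions. -/
noncomputable def differentialsBasis : Module.Basis T L Ω[L⁄k] :=
  (KaehlerDifferential.mvPolynomialBasis k T).ofIsLocalizedModule L
    (nonZeroDivisors (MvPolynomial T k)) (KaehlerDifferential.map k k (MvPolynomial T k) L)

theorem differentialsBasis_repr_D (f : MvPolynomial T k) (t : T) :
    (differentialsBasis k L T).repr (KaehlerDifferential.D k L (algebraMap _ L f)) t =
      algebraMap _ L (pderiv t f) := by
  rw [← KaehlerDifferential.map_D k k, differentialsBasis,
    Module.Basis.ofIsLocalizedModule_repr_apply, KaehlerDifferential.mvPolynomialBasis_repr_apply]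

variable (k L T) in
theorem finrank_differentials_eq_trdeg [Finite T] :
    (Module.finrank L Ω[L⁄k] : Cardinal) = Algebra.trdeg k L := by
  have := Fintype.ofFinite T
  have halg : Algebra.IsAlgebraic (MvPolynomial T k) L :=
    IsLocalization.isAlgebraic L (nonZeroDivisors (MvPolynomial T k))
  have htrdeg :=
    ((IsTranscendenceBasis.mvPolynomial T k).algebraMap_comp (A := L)).lift_cardinalMk_eq_trdeg
  rw [Cardinal.mk_fintype, Cardinal.lift_natCast] at htrdeg
  rw [Module.finrank_eq_card_basis (differentialsBasis k L T)]
  exact Cardinal.lift_injective (by rw [← htrdeg, Cardinal.lift_natCast])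

theorem sum_smul_D_eq_zero_iff_mem_conormalSpace {E : Type*} [Finite T] [Fintype E]
    {f : E → MvPolynomial T k} {c : E → L} :
    ∑ e, c e • KaehlerDifferential.D k L (algebraMap _ L (f e)) = 0 ↔ c ∈ conormalSpace L f := by
  classical
  have := Fintype.ofFinite T
  rw [← (differentialsBasis k L T).repr.map_eq_zero_iff, Finsupp.ext_iff]
  simp only [conormalSpace, Set.mem_ofPred_eq, map_sum, map_smul, Finsupp.coe_finsetSum,
    Finset.sum_apply, Finsupp.smul_apply, differentialsBasis_repr_D, smul_eq_mul,
    Finsupp.zero_apply, mkDerivation_eq_sum_pderiv, Finset.mul_sum]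
  constructor
  · intro h w
    rw [Finset.sum_comm]
    refine Finset.sum_eq_zero fun t _ => ?_
    simp only [← mul_assoc, ← Finset.sum_mul, h, zero_mul]
  · intro h t
    simpa [Pi.single_apply] using h (Pi.single t 1)

theorem separablyAlgebraicallyIndependent_iff_containsNoSupport {E : Type*} [Finite T] [Fintype E]
    {f : E → MvPolynomial T k} {S : Set E} :
    SeparablyAlgebraicallyIndependent k (fun e : S => algebraMap _ L (f e)) ↔
      ContainsNoSupport S (conormalSpace L f) := by
  have := essFiniteType_of_isFractionRing_mvPolynomial k L T
  rw [separablyAlgebraicallyIndependent_iff_linearIndependent_D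
    (finrank_differentials_eq_trdeg k L T)]
  change LinearIndepOn L (fun e => KaehlerDifferential.D k L (algebraMap _ L (f e))) S ↔ _
  simp only [linearIndepOn_iff_containsNoSupport, sum_smul_D_eq_zero_iff_mem_conormalSpace,
    Set.ofPred_mem_eq]

end FractionField

/-! ### Function fields of rational varieties -/

theorem IsSeparatingTranscendenceBasis.map_algEquiv {k K L ι : Type*} [Field k] [Field K] [Field L]
    [Algebra k K] [Algebra k L] {c : ι → K} (h : IsSeparatingTranscendenceBasis k c)
    (Φ : K ≃ₐ[k] L) : IsSeparatingTranscendenceBasis k fun i => Φ (c i) := by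
  obtain ⟨hindep, hfinite, hseparable⟩ := h
  have hrange : IntermediateField.adjoin k (Set.range fun i => Φ (c i)) =
      (IntermediateField.adjoin k (Set.range c)).map Φ.toAlgHom := by
    rw [IntermediateField.adjoin_map, ← Set.range_comp]
    rfl
  rw [IsSeparatingTranscendenceBasis, hrange]
  let φ := IntermediateField.intermediateFieldMap Φ (IntermediateField.adjoin k (Set.range c))
  exact ⟨hindep.map' (f := Φ.toAlgHom) Φ.injective,
    Module.Finite.of_equiv_equiv φ.toRingEquiv Φ.toRingEquiv rfl,
    Algebra.IsSeparable.of_equiv_equiv φ.toRingEquiv Φ.toRingEquiv rfl⟩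

theorem SeparablyAlgebraicallyIndependent.map_algEquiv {k K L ι : Type*} [Field k] [Field K]
    [Field L] [Algebra k K] [Algebra k L] {a : ι → K} (h : SeparablyAlgebraicallyIndependent k a)
    (Φ : K ≃ₐ[k] L) : SeparablyAlgebraicallyIndependent k fun i => Φ (a i) := by
  obtain ⟨q, b, hab⟩ := h
  refine ⟨q, fun i => Φ (b i), ?_⟩
  convert hab.map_algEquiv Φ using 1
  exact (Sum.comp_elim Φ a b).symm

theorem separablyAlgebraicallyIndependent_algEquiv_iff {k K L ι : Type*} [Field k] [Field K]
    [Field L] [Algebra k K] [Algebra k L] {a : ι → K} (Φ : K ≃ₐ[k] L) :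
    SeparablyAlgebraicallyIndependent k (fun i => Φ (a i)) ↔
      SeparablyAlgebraicallyIndependent k a :=
  ⟨fun h => by simpa using h.map_algEquiv Φ.symm, fun h => h.map_algEquiv Φ⟩

section FunctionField

variable {k T : Type*} [Field k] {m n : ℕ}
  {Y : Set (Matrix (Fin m) (Fin n) (AlgebraicClosure k))} {φ : Fin m × Fin n → MvPolynomial T k}

theorem matrixIdeal_isPrime_of_eq_ker
    (hI : matrixIdeal k Y = RingHom.ker (MvPolynomial.aeval φ).toRingHom) :
    (matrixIdeal k Y).IsPrime :=
  hI ▸ RingHom.ker_isPrime _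

theorem exists_injective_coordinateRing
    (hI : matrixIdeal k Y = RingHom.ker (MvPolynomial.aeval φ).toRingHom) :
    ∃ ψ : CoordinateRing k Y →ₐ[k] MvPolynomial T k, Function.Injective ψ ∧
      ∀ e, ψ (Ideal.Quotient.mk _ (MvPolynomial.X e)) = φ e := by
  refine ⟨Ideal.Quotient.liftₐ (matrixIdeal k Y) (MvPolynomial.aeval φ) fun a ha => ?_, ?_,
    fun e => MvPolynomial.aeval_X φ e⟩
  · rwa [hI] at ha
  · rw [injective_iff_map_eq_zero]
    intro a ha
    obtain ⟨a, rfl⟩ := Ideal.Quotient.mk_surjective a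
    rw [Ideal.Quotient.eq_zero_iff_mem, hI]
    exact ha

theorem exists_algEquiv_functionField [(matrixIdeal k Y).IsPrime]
    (hI : matrixIdeal k Y = RingHom.ker (MvPolynomial.aeval φ).toRingHom)
    (hgen : IntermediateField.adjoin k (Set.range fun e =>
      algebraMap _ (FractionRing (MvPolynomial T k)) (φ e)) = ⊤) :
    ∃ E : FunctionField k Y ≃ₐ[k] FractionRing (MvPolynomial T k),
      ∀ e, E (coordinateFunction k Y e) = algebraMap _ _ (φ e) := by
  obtain ⟨ψ, hψ, hψX⟩ := exists_injective_coordinateRing hI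
  let K := FractionRing (MvPolynomial T k)
  let ι := IsScalarTower.toAlgHom k (MvPolynomial T k) K
  have hι : Function.Injective (ι.comp ψ) :=
    (IsFractionRing.injective (MvPolynomial T k) K).comp hψ
  let Ψ : FunctionField k Y →ₐ[k] K := IsFractionRing.liftAlgHom (K := FunctionField k Y) hι
  have hΨ (e) : Ψ (coordinateFunction k Y e) = algebraMap _ K (φ e) :=
    (IsFractionRing.lift_algebraMap hι _).trans (congrArg ι (hψX e))
  have hsurj : Function.Surjective Ψ := by
    rw [← AlgHom.fieldRange_eq_top, eq_top_iff, ← hgen, IntermediateField.adjoin_le_iff]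
    rintro _ ⟨e, rfl⟩
    exact ⟨_, hΨ e⟩
  exact ⟨AlgEquiv.ofBijective Ψ ⟨Ψ.toRingHom.injective, hsurj⟩, hΨ⟩

end FunctionField

/-! ### Symmetric and alternating matrices -/

/-- The two symmetry types of bilinear forms. -/
inductive Symmetry
  | symmetric
  | alternating

/-- The factor by which a matrix of the given symmetry type is multiplied under transposition. -/
def Symmetry.sign (R : Type*) [CommRing R] : Symmetry → R
  | symmetric => 1
  | alternating => -1

theorem Symmetry.sign_mul_self (R : Type*) [CommRing R] (s : Symmetry) :
    s.sign R * s.sign R = 1 := by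
  cases s <;> simp [sign]

theorem Symmetry.map_sign_mul {R S Φ : Type*} [CommRing R] [CommRing S] [FunLike Φ R S]
    [AddMonoidHomClass Φ R S] (f : Φ) (s : Symmetry) (x : R) :
    f (s.sign R * x) = s.sign S * f x := by
  cases s <;> simp [sign]

/-- Symmetric matrices, respectively alternating ones: skew-symmetric with zero diagonal. -/
structure HasSymmetry {R ι : Type*} [CommRing R] (s : Symmetry) (M : Matrix ι ι R) : Prop where
  transpose_eq : Mᵀ = s.sign R • M
  diag_eq_zero : s = .alternating → ∀ i, M i i = 0

theorem hasSymmetry_symmetric_iff {R ι : Type*} [CommRing R] {M : Matrix ι ι R} :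
    HasSymmetry .symmetric M ↔ M.IsSymm :=
  ⟨fun h => h.transpose_eq.trans (one_smul R M), fun h => ⟨h.trans (one_smul R M).symm, nofun⟩⟩

theorem hasSymmetry_alternating_iff {R ι : Type*} [CommRing R] {M : Matrix ι ι R} :
    HasSymmetry .alternating M ↔ Mᵀ = -M ∧ ∀ i, M i i = 0 := by
  rw [← neg_one_smul R M]
  exact ⟨fun h => ⟨h.transpose_eq, h.diag_eq_zero rfl⟩, fun h => ⟨h.1, fun _ => h.2⟩⟩

namespace HasSymmetry

variable {R S ι κ : Type*} [CommRing R] [CommRing S] {s : Symmetry} {M : Matrix ι ι R}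

theorem apply_swap (h : HasSymmetry s M) (i j : ι) : M j i = s.sign R * M i j :=
  congrFun₂ h.transpose_eq i j

theorem map {Φ : Type*} [FunLike Φ R S] [AddMonoidHomClass Φ R S] (h : HasSymmetry s M) (f : Φ) :
    HasSymmetry s (M.map f) := by
  refine ⟨?_, fun hs i => ?_⟩
  · ext i j
    rw [Matrix.transpose_apply, Matrix.map_apply, h.apply_swap i j, Symmetry.map_sign_mul]
    rfl
  · rw [Matrix.map_apply, h.diag_eq_zero hs, map_zero]

theorem submatrix (h : HasSymmetry s M) (f : κ → ι) : HasSymmetry s (M.submatrix f f) :=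
  ⟨by ext i j; exact h.apply_swap _ _, fun hs _ => h.diag_eq_zero hs _⟩

/-- On the diagonal of an alternating product the summands `(x, y)` and `(y, x)` cancel. -/
theorem mul_mul_transpose [Fintype ι] (h : HasSymmetry s M) (U : Matrix κ ι R) :
    HasSymmetry s (U * M * Uᵀ) := by
  refine ⟨?_, ?_⟩
  · rw [Matrix.transpose_mul, Matrix.transpose_mul, Matrix.transpose_transpose, h.transpose_eq,
      Matrix.smul_mul, Matrix.mul_smul, Matrix.mul_assoc]
  · rintro rfl i
    simp only [Matrix.mul_apply, Finset.sum_mul, Matrix.transpose_apply]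
    rw [← Finset.sum_product' Finset.univ Finset.univ fun y x => U i x * M x y * U i y]
    refine Finset.sum_involution (fun x _ => x.swap) ?_ ?_ (by simp) (by simp)
    · rintro ⟨x, y⟩ -
      simp only [Prod.fst_swap, Prod.snd_swap, h.apply_swap x y, Symmetry.sign]
      ring
    · rintro ⟨x, y⟩ - hne heq
      obtain rfl : y = x := congrArg Prod.fst heq
      exact hne (by simp [h.diag_eq_zero rfl])

end HasSymmetry

/-- The positions of the free entries: on or above the diagonal, respectively strictly above. -/
def Symmetry.EntryRel {n : ℕ} : Symmetry → Fin n → Fin n → Prop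
  | symmetric, i, j => i ≤ j
  | alternating, i, j => i < j

instance {n : ℕ} (s : Symmetry) (i j : Fin n) : Decidable (s.EntryRel i j) := by
  cases s <;> unfold Symmetry.EntryRel <;> infer_instance

/-- The index set of the free entries of an `n × n` matrix of the given symmetry type; it is
`SymIndex n`, respectively `SkewIndex n`, by definition. -/
abbrev EntryIndex (s : Symmetry) (n : ℕ) : Type := {e : Fin n × Fin n // s.EntryRel e.1 e.2}

section Entries

variable {R S : Type*} [CommRing R] [CommRing S] {s : Symmetry} {n : ℕ}

theorem Symmetry.EntryRel.le {i j : Fin n} (h : s.EntryRel i j) : i ≤ j := by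
  cases s
  · exact h
  · exact le_of_lt h

theorem Symmetry.EntryRel.of_lt {i j : Fin n} (h : i < j) : s.EntryRel i j := by
  cases s
  · exact le_of_lt h
  · exact h

theorem Symmetry.EntryRel.eq_symmetric {i : Fin n} (h : s.EntryRel i i) : s = .symmetric := by
  cases s
  · rfl
  · exact absurd h (lt_irrefl i)

/-- The matrix of the given symmetry type with prescribed free entries, as a linear function of
these entries. -/
def ofEntries (s : Symmetry) : (EntryIndex s n → R) →ₗ[R] Matrix (Fin n) (Fin n) R where
  toFun c := Matrix.of fun i j =>
    if h : s.EntryRel i j then c ⟨(i, j), h⟩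
    else if h : s.EntryRel j i then s.sign R * c ⟨(j, i), h⟩ else 0
  map_add' c c' := by
    ext i j
    simp only [Matrix.of_apply, Matrix.add_apply, Pi.add_apply]
    split_ifs <;> simp only [mul_add, add_zero]
  map_smul' a c := by
    ext i j
    simp only [Matrix.of_apply, Matrix.smul_apply, Pi.smul_apply, RingHom.id_apply]
    split_ifs <;> simp only [mul_smul_comm, smul_zero]

theorem ofEntries_apply (c : EntryIndex s n → R) (e : EntryIndex s n) :
    ofEntries s c e.1.1 e.1.2 = c e :=
  dif_pos e.2

theorem hasSymmetry_ofEntries (c : EntryIndex s n → R) : HasSymmetry s (ofEntries s c) := by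
  refine ⟨?_, ?_⟩
  · ext i j
    simp only [ofEntries, LinearMap.coe_mk, AddHom.coe_mk, Matrix.of_apply, Matrix.transpose_apply,
      Matrix.smul_apply, smul_eq_mul]
    by_cases hij : s.EntryRel i j <;> by_cases hji : s.EntryRel j i
    · obtain rfl := le_antisymm hij.le hji.le
      obtain rfl := hij.eq_symmetric
      simp [Symmetry.sign]
    · simp [hij, hji]
    · simp [hij, hji, ← mul_assoc, Symmetry.sign_mul_self]
    · simp [hij, hji]
  · rintro rfl i
    have : ¬ Symmetry.alternating.EntryRel i i := lt_irrefl i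
    simp [ofEntries, this]

theorem HasSymmetry.ext {M N : Matrix (Fin n) (Fin n) R} (hM : HasSymmetry s M)
    (hN : HasSymmetry s N) (h : ∀ e : EntryIndex s n, M e.1.1 e.1.2 = N e.1.1 e.1.2) : M = N := by
  ext i j
  rcases lt_trichotomy i j with hij | rfl | hij
  · exact h ⟨(i, j), .of_lt hij⟩
  · cases s
    · exact h ⟨(i, i), le_refl i⟩
    · rw [hM.diag_eq_zero rfl, hN.diag_eq_zero rfl]
  · rw [hM.apply_swap j i, hN.apply_swap j i, h ⟨(j, i), .of_lt hij⟩]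

theorem HasSymmetry.ofEntries_eq {M : Matrix (Fin n) (Fin n) R} (hM : HasSymmetry s M) :
    ofEntries s (fun e => M e.1.1 e.1.2) = M :=
  (hasSymmetry_ofEntries _).ext hM (ofEntries_apply _)

theorem ofEntries_map {Φ : Type*} [FunLike Φ R S] [AddMonoidHomClass Φ R S]
    (c : EntryIndex s n → R) (f : Φ) : (ofEntries s c).map f = ofEntries s fun e => f (c e) :=
  ((hasSymmetry_ofEntries c).map f).ext (hasSymmetry_ofEntries _) fun e => by
    rw [Matrix.map_apply, ofEntries_apply, ofEntries_apply]

end Entries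

/-! ### Entries of products `U * B * Vᵀ` -/

section ProductEntries

variable {R ι κ ρ τ σ : Type*} [CommRing R] [Fintype ρ] [Fintype τ]

/-- The matrices `U * B * Vᵀ`, viewed as functions of the position of an entry. -/
def productEntries (U : Matrix ι ρ R) (V : Matrix κ τ R) : Set (ι × κ → R) :=
  Set.range fun (B : Matrix ρ τ R) e => (U * B * Vᵀ) e.1 e.2

/-- The matrices `U * B * Uᵀ` with `B` of symmetry type `s`, viewed as functions of the position of
a free entry. -/
def symmetryProductEntries {n : ℕ} (s : Symmetry) (U : Matrix (Fin n) ρ R) :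
    Set (EntryIndex s n → R) :=
  (fun (B : Matrix ρ ρ R) e => (U * B * Uᵀ) e.1.1 e.1.2) '' {B | HasSymmetry s B}

theorem mul_mul_transpose_apply (U : Matrix ι ρ R) (B : Matrix ρ τ R) (V : Matrix κ τ R)
    (i : ι) (j : κ) : (U * B * Vᵀ) i j = U i ⬝ᵥ B *ᵥ V j := by
  rw [Matrix.mul_assoc, Matrix.mul_apply']
  rfl

end ProductEntries

/-! ### Independence in the dual of a represented matroid -/

theorem representedMatroid_dual_indep_iff {F V α : Type*} [Field F] [AddCommGroup V] [Module F V]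
    [Finite α] {v : α → V} {S : Set α} :
    (representedMatroid F v).dual.Indep S ↔
      ContainsNoSupport S (Set.range fun (f : Module.Dual F V) e => f (v e)) := by
  set M := representedMatroid F v
  have hE (X : Set α) : X ⊆ M.E := Set.subset_univ X
  have hspan {B X : Set α} (hB : M.IsBasis B X) {e : α} (he : e ∈ X) :
      v e ∈ Submodule.span F (v '' B) := by
    by_cases heB : e ∈ B
    · exact Submodule.subset_span ⟨e, heB, rfl⟩
    · by_contra hne
      exact heB (hB.mem_of_insert_indep he ((linearIndepOn_insert heB).2 ⟨hB.indep, hne⟩))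
  change M.Coindep S ↔ _
  rw [Matroid.coindep_iff_exists (hX := hE S), ContainsNoSupport, Set.forall_mem_range]
  constructor
  · rintro ⟨B, hB, hBS⟩ f hf
    have hker : Submodule.span F (v '' B) ≤ LinearMap.ker f := by
      rw [Submodule.span_le]
      rintro _ ⟨x, hx, rfl⟩
      exact hf x (hBS hx).2
    exact funext fun e => hker (hspan hB.isBasis_ground (hE Set.univ trivial))
  · intro h
    obtain ⟨B, hB⟩ := M.exists_isBasis (M.E \ S)
    refine ⟨B, hB.indep.isBase_of_forall_insert fun e he hi => ?_, hB.subset⟩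
    have hne := ((linearIndepOn_insert he.2).1 hi).2
    obtain ⟨f, hf, hfB⟩ := Submodule.exists_le_ker_of_notMem hne
    exact hf (congrFun (h f fun x hx => hfB (hspan hB ⟨hE Set.univ trivial, hx⟩)) e)

section Functionals

variable {F : Type*} [Field F] {m n r t : ℕ}

theorem range_dual_tmul (u : Fin m → Fin t → F) (v : Fin n → Fin r → F) :
    (Set.range fun (f : Module.Dual F ((Fin t → F) ⊗[F] (Fin r → F))) (e : Fin m × Fin n) =>
      f (u e.1 ⊗ₜ v e.2)) = productEntries (Matrix.of u) (Matrix.of v) := by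
  apply subset_antisymm
  · rintro _ ⟨f, rfl⟩
    refine ⟨LinearMap.toMatrix₂' F (TensorProduct.curry f), funext fun e => ?_⟩
    refine (mul_mul_transpose_apply _ _ _ _ _).trans ?_
    rw [← Matrix.toLinearMap₂'_apply', Matrix.toLinearMap₂'_toMatrix']
    rfl
  · rintro _ ⟨B, rfl⟩
    refine ⟨TensorProduct.lift (Matrix.toLinearMap₂' F B), funext fun e => ?_⟩
    exact (Matrix.toLinearMap₂'_apply' B (u e.1) (v e.2)).trans
      (mul_mul_transpose_apply _ _ _ _ _).symm

theorem tensorMatroid_dual_indep_iff {u : Fin m → Fin t → F} {v : Fin n → Fin r → F}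
    {S : Set (Fin m × Fin n)} :
    (tensorMatroid u v).dual.Indep S ↔
      ContainsNoSupport S (productEntries (Matrix.of u) (Matrix.of v)) := by
  rw [tensorMatroid, representedMatroid_dual_indep_iff, range_dual_tmul]

theorem range_dual_eq_symmetryProductEntries {s : Symmetry} {V : Type*} [AddCommGroup V]
    [Module F V] (p : (Fin r → F) → (Fin r → F) → V)
    (hform : ∀ f : Module.Dual F V, ∃ B : Matrix (Fin r) (Fin r) F,
      HasSymmetry s B ∧ ∀ x y, f (p x y) = x ⬝ᵥ B *ᵥ y)
    (hdual : ∀ B : Matrix (Fin r) (Fin r) F, HasSymmetry s B →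
      ∃ f : Module.Dual F V, ∀ x y, f (p x y) = x ⬝ᵥ B *ᵥ y) (v : Fin n → Fin r → F) :
    (Set.range fun (f : Module.Dual F V) (e : EntryIndex s n) => f (p (v e.1.1) (v e.1.2))) =
      symmetryProductEntries s (Matrix.of v) := by
  apply subset_antisymm
  · rintro _ ⟨f, rfl⟩
    obtain ⟨B, hB, hf⟩ := hform f
    exact ⟨B, hB, funext fun e => (mul_mul_transpose_apply _ _ _ _ _).trans (hf _ _).symm⟩
  · rintro _ ⟨B, hB, rfl⟩
    obtain ⟨f, hf⟩ := hdual B hB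
    exact ⟨f, funext fun e => (hf _ _).trans (mul_mul_transpose_apply _ _ _ _ _).symm⟩

/-! ### Functionals on symmetric and exterior squares -/

open SymmetricAlgebra in
theorem exists_hasSymmetry_symmetric_of_dual
    (f : Module.Dual F (SymmetricAlgebra F (Fin r → F))) :
    ∃ B : Matrix (Fin r) (Fin r) F, HasSymmetry .symmetric B ∧
      ∀ x y, f (ι F _ x * ι F _ y) = x ⬝ᵥ B *ᵥ y := by
  let g : (Fin r → F) →ₗ[F] (Fin r → F) →ₗ[F] F :=
    ((LinearMap.mul F (SymmetricAlgebra F (Fin r → F))).compr₂ f).compl₁₂ (ι F _) (ι F _)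
  have hg (x y) : g x y = f (ι F _ x * ι F _ y) := rfl
  refine ⟨LinearMap.toMatrix₂' F g, hasSymmetry_symmetric_iff.2 (Matrix.IsSymm.ext fun a b => ?_),
    fun x y => ?_⟩
  · simp only [LinearMap.toMatrix₂'_apply, hg, mul_comm]
  · rw [← hg, ← Matrix.toLinearMap₂'_apply', Matrix.toLinearMap₂'_toMatrix']

theorem exists_coefficient_of_isSymm {α : Type*} {B : Matrix α α F} (hB : B.IsSymm) :
    ∃ g : MvPolynomial α F →ₗ[F] F, ∀ a b, g (MvPolynomial.X a * MvPolynomial.X b) = B a b := by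
  let degree (p : α × α) : α →₀ ℕ := .single p.1 1 + .single p.2 1
  have hfactors : (fun p : α × α => B p.1 p.2).FactorsThrough degree := by
    rintro ⟨a, b⟩ ⟨a', b'⟩ h
    rcases (Finsupp.single_add_single_eq_single_add_single one_ne_zero one_ne_zero).1 h with
      ⟨rfl, rfl⟩ | ⟨-, rfl, rfl⟩ | ⟨h, -⟩
    · rfl
    · exact hB.apply b a
    · exact absurd h two_ne_zero
  refine ⟨(MvPolynomial.basisMonomials α F).constr F (degree.extend (fun p => B p.1 p.2) 0),
    fun a b => ?_⟩
  have hmonomial : (MvPolynomial.X a * MvPolynomial.X b : MvPolynomial α F) =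
      MvPolynomial.basisMonomials α F (degree (a, b)) := by
    rw [MvPolynomial.coe_basisMonomials, MvPolynomial.X, MvPolynomial.X,
      MvPolynomial.monomial_mul, one_mul]
  rw [hmonomial, Module.Basis.constr_basis]
  exact hfactors.extend_apply 0 (a, b)

open SymmetricAlgebra in
theorem exists_dual_of_hasSymmetry_symmetric {B : Matrix (Fin r) (Fin r) F}
    (hB : HasSymmetry .symmetric B) :
    ∃ f : Module.Dual F (SymmetricAlgebra F (Fin r → F)),
      ∀ x y, f (ι F _ x * ι F _ y) = x ⬝ᵥ B *ᵥ y := by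
  obtain ⟨g, hg⟩ := exists_coefficient_of_isSymm (hasSymmetry_symmetric_iff.1 hB)
  let Φ := equivMvPolynomial (Pi.basisFun F (Fin r))
  have hΦ (x : Fin r → F) : Φ (ι F _ x) = ∑ a, x a • MvPolynomial.X a := by
    conv_lhs => rw [← (Pi.basisFun F (Fin r)).sum_repr x]
    simp only [map_sum, map_smul, Φ, equivMvPolynomial_ι_apply, Pi.basisFun_repr]
  refine ⟨g ∘ₗ Φ.toLinearMap, fun x y => ?_⟩
  rw [LinearMap.comp_apply, AlgEquiv.toLinearMap_apply, map_mul, hΦ, hΦ, Finset.sum_mul_sum]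
  simp only [map_sum, smul_mul_smul_comm, map_smul, hg, smul_eq_mul, dotProduct, Matrix.mulVec,
    Finset.mul_sum, mul_assoc, mul_comm (y _)]

theorem symmetricPowerMatroid_dual_indep_iff {v : Fin n → Fin r → F} {S : Set (SymIndex n)} :
    (symmetricPowerMatroid v).dual.Indep S ↔
      ContainsNoSupport S (symmetryProductEntries .symmetric (Matrix.of v)) := by
  rw [symmetricPowerMatroid, representedMatroid_dual_indep_iff,
    ← range_dual_eq_symmetryProductEntries _ exists_hasSymmetry_symmetric_of_dual
      fun _ => exists_dual_of_hasSymmetry_symmetric]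
  rfl

/-- The alternating form `x, y ↦ x ⬝ᵥ B *ᵥ y` of an alternating matrix `B`. -/
def HasSymmetry.alternatingMap {B : Matrix (Fin r) (Fin r) F} (hB : HasSymmetry .alternating B) :
    (Fin r → F) [⋀^Fin 2]→ₗ[F] F where
  toFun v := v 0 ⬝ᵥ B *ᵥ v 1
  map_update_add' v i x y := by
    fin_cases i <;> simp [Matrix.mulVec_add, add_dotProduct, dotProduct_add]
  map_update_smul' v i c x := by
    fin_cases i <;> simp [Matrix.mulVec_smul]
  map_eq_zero_of_eq' v i j h hij := by
    have h01 : v 0 = v 1 := by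
      fin_cases i <;> fin_cases j <;> simp_all
    have := (hB.mul_mul_transpose (Matrix.of fun _ : Unit => v 1)).diag_eq_zero rfl ()
    rw [mul_mul_transpose_apply] at this
    rwa [h01]

theorem exists_hasSymmetry_alternating_of_alternatingMap (a : (Fin r → F) [⋀^Fin 2]→ₗ[F] F) :
    ∃ B : Matrix (Fin r) (Fin r) F, HasSymmetry .alternating B ∧
      ∀ x y, a ![x, y] = x ⬝ᵥ B *ᵥ y := by
  have hswap (x y) : a ![y, x] = - a ![x, y] := by
    rw [← a.map_swap _ (show (0 : Fin 2) ≠ 1 by decide)]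
    congr 1
    ext i : 1
    fin_cases i <;> rfl
  have hadd (x x' y) : a ![x + x', y] = a ![x, y] + a ![x', y] := a.map_vecCons_add ![y] x x'
  have hsmul (c : F) (x y) : a ![c • x, y] = c • a ![x, y] := a.map_vecCons_smul ![y] c x
  let g : (Fin r → F) →ₗ[F] (Fin r → F) →ₗ[F] F :=
    LinearMap.mk₂ F (fun x y => a ![x, y]) hadd hsmul
      (fun x y y' => by rw [hswap, hadd, neg_add, ← hswap, ← hswap])
      (fun c x y => by rw [hswap, hsmul, ← smul_neg, ← hswap])
  have hg (x y) : g x y = a ![x, y] := rfl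
  refine ⟨LinearMap.toMatrix₂' F g, hasSymmetry_alternating_iff.2 ⟨?_, fun i => ?_⟩, fun x y => ?_⟩
  · ext i j
    rw [Matrix.transpose_apply, Matrix.neg_apply, LinearMap.toMatrix₂'_apply,
      LinearMap.toMatrix₂'_apply, hg, hg, hswap]
  · rw [LinearMap.toMatrix₂'_apply, hg]
    exact a.map_eq_zero_of_eq _ (i := 0) (j := 1) rfl (by decide)
  · rw [← hg, ← Matrix.toLinearMap₂'_apply', Matrix.toLinearMap₂'_toMatrix']

theorem wedgePowerMatroid_dual_indep_iff {v : Fin n → Fin r → F} {S : Set (SkewIndex n)} :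
    (wedgePowerMatroid v).dual.Indep S ↔
      ContainsNoSupport S (symmetryProductEntries .alternating (Matrix.of v)) := by
  rw [wedgePowerMatroid, representedMatroid_dual_indep_iff,
    ← range_dual_eq_symmetryProductEntries (fun x y => exteriorPower.ιMulti F 2 ![x, y])]
  · rfl
  · exact fun f => exists_hasSymmetry_alternating_of_alternatingMap
      (f.compAlternatingMap (exteriorPower.ιMulti F 2))
  · exact fun B hB => ⟨exteriorPower.alternatingMapLinearEquiv hB.alternatingMap, fun x y =>
      exteriorPower.alternatingMapLinearEquiv_apply_ιMulti _ _⟩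

end Functionals

/-! ### Frames and coframes -/

section Inclusions

variable (R : Type*) {S ι δ ρ : Type*} [CommRing R] [CommRing S] [DecidableEq ι] (e : ι ≃ δ ⊕ ρ)

/-- The inclusion of the first block of coordinates, as a matrix. -/
def headInclusion : Matrix ι δ R := (1 : Matrix ι ι R).submatrix id (e.symm ∘ Sum.inl)

/-- The inclusion of the second block of coordinates, as a matrix. -/
def tailInclusion : Matrix ι ρ R := (1 : Matrix ι ι R).submatrix id (e.symm ∘ Sum.inr)

variable {R} in
theorem headInclusion_map (f : R →+* S) : (headInclusion R e).map f = headInclusion S e := by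
  rw [headInclusion, ← Matrix.submatrix_map, Matrix.map_one f (map_zero f) (map_one f)]
  rfl

variable {R} in
theorem tailInclusion_map (f : R →+* S) : (tailInclusion R e).map f = tailInclusion S e := by
  rw [tailInclusion, ← Matrix.submatrix_map, Matrix.map_one f (map_zero f) (map_one f)]
  rfl

theorem headInclusion_mul_transpose_add_tailInclusion_mul_transpose [Fintype δ] [Fintype ρ] :
    headInclusion R e * (headInclusion R e)ᵀ + tailInclusion R e * (tailInclusion R e)ᵀ = 1 := by
  have := Fintype.ofEquiv _ e.symm
  have hcols : Matrix.fromCols (headInclusion R e) (tailInclusion R e) =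
      (1 : Matrix ι ι R).submatrix id e.symm := by
    ext i (j | j) <;> rfl
  rw [← Matrix.fromCols_mul_fromRows, ← Matrix.transpose_fromCols, hcols,
    Matrix.transpose_submatrix, Matrix.transpose_one, Matrix.submatrix_mul_equiv, Matrix.one_mul]
  exact Matrix.submatrix_one id Function.injective_id

variable [Fintype ι]

variable {R} in
theorem headInclusion_transpose_mul {κ : Type*} (M : Matrix ι κ R) :
    (headInclusion R e)ᵀ * M = M.submatrix (e.symm ∘ Sum.inl) id := by
  rw [headInclusion, Matrix.transpose_submatrix, Matrix.transpose_one]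
  exact Matrix.one_submatrix_mul _ (Equiv.refl ι) M

variable {R} in
theorem tailInclusion_transpose_mul {κ : Type*} (M : Matrix ι κ R) :
    (tailInclusion R e)ᵀ * M = M.submatrix (e.symm ∘ Sum.inr) id := by
  rw [tailInclusion, Matrix.transpose_submatrix, Matrix.transpose_one]
  exact Matrix.one_submatrix_mul _ (Equiv.refl ι) M

variable {R} in
theorem mul_headInclusion_apply {κ : Type*} (M : Matrix κ ι R) (i : κ) (j : δ) :
    (M * headInclusion R e) i j = M i (e.symm (.inl j)) := by
  simp [headInclusion, Matrix.mul_apply, Matrix.one_apply]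

theorem headInclusion_transpose_mul_self [DecidableEq δ] :
    (headInclusion R e)ᵀ * headInclusion R e = 1 := by
  rw [headInclusion_transpose_mul, headInclusion, Matrix.submatrix_submatrix]
  exact Matrix.submatrix_one _ (e.symm.injective.comp Sum.inl_injective)

theorem tailInclusion_transpose_mul_self [DecidableEq ρ] :
    (tailInclusion R e)ᵀ * tailInclusion R e = 1 := by
  rw [tailInclusion_transpose_mul, tailInclusion, Matrix.submatrix_submatrix]
  exact Matrix.submatrix_one _ (e.symm.injective.comp Sum.inr_injective)

theorem headInclusion_transpose_mul_tailInclusion :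
    (headInclusion R e)ᵀ * tailInclusion R e = 0 := by
  rw [headInclusion_transpose_mul]
  ext i j
  simp [tailInclusion]

theorem tailInclusion_transpose_mul_headInclusion :
    (tailInclusion R e)ᵀ * headInclusion R e = 0 := by
  rw [tailInclusion_transpose_mul]
  ext i j
  simp [headInclusion]

variable [Fintype δ] [Fintype ρ]

theorem eq_headInclusion_mul_add_tailInclusion_mul {κ : Type*} (M : Matrix ι κ R) :
    M = headInclusion R e * ((headInclusion R e)ᵀ * M) +
      tailInclusion R e * ((tailInclusion R e)ᵀ * M) := by
  rw [← Matrix.mul_assoc, ← Matrix.mul_assoc, ← Matrix.add_mul,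
    headInclusion_mul_transpose_add_tailInclusion_mul_transpose, Matrix.one_mul]

end Inclusions

section Frames

variable {R S ι κ δ ρ : Type*} [CommRing R] [CommRing S] [DecidableEq ι] (e : ι ≃ δ ⊕ ρ)

/-- The matrix with an identity block on top of `P`. Its columns are the normalized basis of a
subspace of dimension `δ` complementary to the second block of coordinates. -/
def frame [Fintype ρ] (P : Matrix ρ δ R) : Matrix ι δ R :=
  headInclusion R e + tailInclusion R e * P

/-- The matrix with `-Pᵀ` on top of an identity block. Its columns are the normalized basis of the
orthogonal complement of the columns of `frame e P`. -/
def coframe [Fintype δ] (P : Matrix ρ δ R) : Matrix ι ρ R :=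
  tailInclusion R e - headInclusion R e * Pᵀ

theorem frame_map [Fintype ρ] (P : Matrix ρ δ R) (f : R →+* S) :
    (frame e P).map f = frame e (P.map f) := by
  rw [frame, frame, ← headInclusion_map e f, ← tailInclusion_map e f, ← Matrix.map_mul,
    Matrix.map_add f (map_add f)]

theorem coframe_map [Fintype δ] (P : Matrix ρ δ R) (f : R →+* S) :
    (coframe e P).map f = coframe e (P.map f) := by
  rw [coframe, coframe, ← headInclusion_map e f, ← tailInclusion_map e f, ← Matrix.transpose_map,
    ← Matrix.map_mul, Matrix.map_sub f (map_sub f)]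

variable [Fintype ι]

theorem headInclusion_transpose_mul_frame [Fintype ρ] [DecidableEq δ] (P : Matrix ρ δ R) :
    (headInclusion R e)ᵀ * frame e P = 1 := by
  rw [frame, Matrix.mul_add, ← Matrix.mul_assoc, headInclusion_transpose_mul_self,
    headInclusion_transpose_mul_tailInclusion, Matrix.zero_mul, add_zero]

theorem tailInclusion_transpose_mul_frame [Fintype ρ] (P : Matrix ρ δ R) :
    (tailInclusion R e)ᵀ * frame e P = P := by
  classical
  rw [frame, Matrix.mul_add, ← Matrix.mul_assoc, tailInclusion_transpose_mul_self,
    tailInclusion_transpose_mul_headInclusion, Matrix.one_mul, zero_add]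

theorem tailInclusion_transpose_mul_coframe [Fintype δ] [DecidableEq ρ] (P : Matrix ρ δ R) :
    (tailInclusion R e)ᵀ * coframe e P = 1 := by
  rw [coframe, Matrix.mul_sub, ← Matrix.mul_assoc, tailInclusion_transpose_mul_self,
    tailInclusion_transpose_mul_headInclusion, Matrix.zero_mul, sub_zero]

variable [Fintype ρ]

theorem frame_transpose_mul (P : Matrix ρ δ R) (M : Matrix ι κ R) :
    (frame e P)ᵀ * M = (headInclusion R e)ᵀ * M + Pᵀ * ((tailInclusion R e)ᵀ * M) := by
  rw [frame, Matrix.transpose_add, Matrix.transpose_mul, Matrix.add_mul, Matrix.mul_assoc]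

variable [Fintype δ]

theorem frame_transpose_mul_coframe (P : Matrix ρ δ R) : (frame e P)ᵀ * coframe e P = 0 := by
  classical
  rw [frame_transpose_mul, tailInclusion_transpose_mul_coframe, coframe, Matrix.mul_sub,
    ← Matrix.mul_assoc, headInclusion_transpose_mul_self, headInclusion_transpose_mul_tailInclusion,
    Matrix.one_mul, Matrix.mul_one, zero_sub, neg_add_cancel]

theorem eq_coframe_mul_of_frame_transpose_mul_eq_zero {P : Matrix ρ δ R} {M : Matrix ι κ R}
    (h : (frame e P)ᵀ * M = 0) : M = coframe e P * ((tailInclusion R e)ᵀ * M) := by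
  rw [frame_transpose_mul] at h
  conv_lhs => rw [eq_headInclusion_mul_add_tailInclusion_mul R e M, eq_neg_of_add_eq_zero_left h]
  rw [coframe, Matrix.sub_mul, Matrix.mul_neg, Matrix.mul_assoc _ Pᵀ, neg_add_eq_sub]

theorem exists_eq_frame_mul [DecidableEq δ] {M : Matrix ι δ R}
    (h : IsUnit ((headInclusion R e)ᵀ * M).det) :
    ∃ (P : Matrix ρ δ R) (G : Matrix δ δ R), M = frame e P * G := by
  refine ⟨(tailInclusion R e)ᵀ * M * ((headInclusion R e)ᵀ * M)⁻¹, (headInclusion R e)ᵀ * M, ?_⟩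
  conv_lhs => rw [eq_headInclusion_mul_add_tailInclusion_mul R e M]
  rw [frame, Matrix.add_mul, Matrix.mul_assoc (tailInclusion R e),
    Matrix.nonsing_inv_mul_cancel_right _ _ h]

theorem exists_eq_coframe_mul [DecidableEq ρ] {M : Matrix ι ρ R}
    (h : IsUnit ((tailInclusion R e)ᵀ * M).det) :
    ∃ P : Matrix ρ δ R, M = coframe e P * ((tailInclusion R e)ᵀ * M) := by
  refine ⟨-((headInclusion R e)ᵀ * M * ((tailInclusion R e)ᵀ * M)⁻¹)ᵀ, ?_⟩
  conv_lhs => rw [eq_headInclusion_mul_add_tailInclusion_mul R e M, add_comm]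
  rw [coframe, Matrix.sub_mul, Matrix.transpose_neg, Matrix.transpose_transpose, Matrix.mul_neg,
    Matrix.neg_mul, sub_neg_eq_add, Matrix.mul_assoc (headInclusion R e),
    Matrix.nonsing_inv_mul_cancel_right _ _ h]

end Frames

/-! ### Factorizations of low-rank matrices -/

section Factorization

variable {K ι κ : Type*} [Field K] [Fintype κ] {d : ℕ}

theorem rank_mul_mul_le (X : Matrix ι (Fin d) K) (C : Matrix (Fin d) (Fin d) K)
    (Y : Matrix (Fin d) κ K) : (X * C * Y).rank ≤ d :=
  calc (X * C * Y).rank ≤ (X * C).rank := Matrix.rank_mul_le_left _ _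
    _ ≤ X.rank := Matrix.rank_mul_le_left _ _
    _ ≤ d := by simpa only [Fintype.card_fin] using X.rank_le_card_width

theorem exists_mul_mul_eq_of_rank_le [Fintype ι] {A : Matrix ι κ K} (h : A.rank ≤ d) :
    ∃ (X : Matrix ι (Fin d) K) (L : Matrix (Fin d) ι K), X * L * A = A := by
  classical
  let W := LinearMap.range A.mulVecLin
  obtain ⟨q, hq⟩ := W.subtype.exists_leftInverse_of_injective W.ker_subtype
  obtain ⟨i, hi⟩ : ∃ i : W →ₗ[K] (Fin d → K), Function.Injective i := by
    have : Module.finrank K W ≤ Module.finrank K (Fin d → K) := by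
      rwa [Module.finrank_fin_fun]
    exact finrank_le_iff_exists_linearMap.1 this
  obtain ⟨j, hj⟩ := i.exists_leftInverse_of_injective (LinearMap.ker_eq_bot.2 hi)
  refine ⟨LinearMap.toMatrix' (W.subtype ∘ₗ j), LinearMap.toMatrix' (i ∘ₗ q), ?_⟩
  rw [← LinearMap.toMatrix'_comp]
  conv_lhs => rw [← LinearMap.toMatrix'_toLin' A]
  conv_rhs => rw [← LinearMap.toMatrix'_toLin' A]
  rw [← LinearMap.toMatrix'_comp]
  congr 1
  have hA (w) : q (A.mulVec w) = ⟨A.mulVec w, w, rfl⟩ :=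
    LinearMap.congr_fun hq ⟨A.mulVec w, w, rfl⟩
  have hji (w) : j (i w) = w := LinearMap.congr_fun hj w
  exact LinearMap.ext fun v => by simp [hA, hji]

theorem exists_eq_mul_mul_transpose_of_rank_le [Finite ι] {A : Matrix ι κ K} (h : A.rank ≤ d) :
    ∃ (X : Matrix ι (Fin d) K) (C : Matrix (Fin d) (Fin d) K) (Y : Matrix κ (Fin d) K),
      A = X * C * Yᵀ := by
  have := Fintype.ofFinite ι
  obtain ⟨X, L, hXL⟩ := exists_mul_mul_eq_of_rank_le h
  refine ⟨X, 1, (L * A)ᵀ, ?_⟩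
  rw [Matrix.mul_one, Matrix.transpose_transpose, ← Matrix.mul_assoc, hXL]

theorem HasSymmetry.exists_eq_mul_mul_transpose_of_rank_le [Fintype ι] {s : Symmetry}
    {A : Matrix ι ι K} (hA : HasSymmetry s A) (h : A.rank ≤ d) :
    ∃ (X : Matrix ι (Fin d) K) (C : Matrix (Fin d) (Fin d) K),
      HasSymmetry s C ∧ A = X * C * Xᵀ := by
  obtain ⟨X, L, hXL⟩ := exists_mul_mul_eq_of_rank_le h
  refine ⟨X, L * A * Lᵀ, hA.mul_mul_transpose L, ?_⟩
  have hright : A * (X * L)ᵀ = A := by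
    have hsign : s.sign K • (A * (X * L)ᵀ) = s.sign K • A := by
      rw [← Matrix.smul_mul, ← hA.transpose_eq, ← Matrix.transpose_mul, hXL]
    simpa only [smul_smul, Symmetry.sign_mul_self, one_smul] using congrArg (s.sign K • ·) hsign
  calc A = X * L * A * (X * L)ᵀ := by rw [hXL, hright]
    _ = X * (L * A * Lᵀ) * Xᵀ := by simp only [Matrix.transpose_mul, Matrix.mul_assoc]

end Factorization

/-! ### Deformation into the domain of a chart -/

section Deformation

open Polynomial

variable {K ι κ δ : Type*} [Field K] [Fintype δ]

theorem aeval_mul_mul_transpose_eq_zero {k : Type*} [Field k] [Algebra k K]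
    {f : MvPolynomial (ι × κ) k} (X : Matrix ι δ K[X]) (B : Matrix δ δ K) (Y : Matrix κ δ K[X])
    (h : MvPolynomial.aeval (fun e : ι × κ =>
      (X.map (algebraMap K[X] (FractionRing K[X])) * B.map (algebraMap K (FractionRing K[X])) *
        (Y.map (algebraMap K[X] (FractionRing K[X])))ᵀ) e.1 e.2) f = 0) :
    MvPolynomial.aeval (fun e : ι × κ =>
      (X.map (evalRingHom 0) * B * (Y.map (evalRingHom 0))ᵀ) e.1 e.2) f = 0 := by
  have hgeneric : X.map (algebraMap K[X] (FractionRing K[X])) *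
      B.map (algebraMap K (FractionRing K[X])) *
        (Y.map (algebraMap K[X] (FractionRing K[X])))ᵀ =
      (X * B.map C * Yᵀ).map (algebraMap K[X] (FractionRing K[X])) := by
    rw [Matrix.map_mul, Matrix.map_mul, Matrix.transpose_map, Matrix.map_map]
    rfl
  have hspecial : X.map (evalRingHom 0) * B * (Y.map (evalRingHom 0))ᵀ =
      (X * B.map C * Yᵀ).map (evalRingHom 0) := by
    rw [Matrix.map_mul, Matrix.map_mul, Matrix.transpose_map, Matrix.map_map]
    congr
    ext i j
    simp
  have hzero : MvPolynomial.aeval (fun e : ι × κ => (X * B.map C * Yᵀ) e.1 e.2) f = 0 := by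
    refine IsFractionRing.injective K[X] (FractionRing K[X]) ?_
    rw [map_zero, ← MvPolynomial.aeval_algebraMap_apply]
    rwa [hgeneric] at h
  have := congrArg ((Polynomial.aeval (0 : K)).restrictScalars k) hzero
  rw [map_zero, MvPolynomial.comp_aeval_apply] at this
  rw [hspecial]
  exact this

theorem exists_eval_zero_eq_and_eq_frame_mul {ρ : Type*} [DecidableEq ι] [Fintype ρ]
    (e : ι ≃ δ ⊕ ρ) (M : Matrix ι δ K) :
    ∃ (N : Matrix ι δ K[X]) (P : Matrix ρ δ (FractionRing K[X]))
      (G : Matrix δ δ (FractionRing K[X])),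
      N.map (evalRingHom 0) = M ∧ N.map (algebraMap K[X] (FractionRing K[X])) = frame e P * G := by
  classical
  have := Fintype.ofEquiv _ e.symm
  -- Adding a multiple of the identity makes the first block generically invertible.
  let N : Matrix ι δ K[X] := M.map C + (X : K[X]) • headInclusion K[X] e
  have hdet : ((headInclusion K[X] e)ᵀ * N).det ≠ 0 := by
    have hhead : (headInclusion K[X] e)ᵀ * N =
        (X : K[X]) • (1 : Matrix δ δ K[X]) + ((headInclusion K e)ᵀ * M).map C := by
      rw [Matrix.mul_add, Matrix.mul_smul, headInclusion_transpose_mul_self, Matrix.map_mul,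
        Matrix.transpose_map, headInclusion_map, add_comm]
    intro h
    have := leadingCoeff_det_X_one_add_C ((headInclusion K e)ᵀ * M)
    rw [← hhead, h, leadingCoeff_zero] at this
    exact zero_ne_one this
  obtain ⟨P, G, hPG⟩ := exists_eq_frame_mul e
    (M := N.map (algebraMap K[X] (FractionRing K[X]))) (by
      rw [← headInclusion_map e (algebraMap K[X] _), ← Matrix.transpose_map, ← Matrix.map_mul,
        ← RingHom.mapMatrix_apply, ← RingHom.map_det, isUnit_iff_ne_zero]
      exact (map_ne_zero_iff _ (IsFractionRing.injective _ _)).2 hdet)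
  refine ⟨N, P, G, ?_, hPG⟩
  ext i j
  simp [N]

end Deformation

/-! ### Charts of the varieties of low-rank matrices -/

section Chart

variable {R S ι κ δ ρ τ : Type*} [CommRing R] [CommRing S] [DecidableEq ι] [DecidableEq κ]
  [Fintype δ] [Fintype ρ] [Fintype τ] (e : ι ≃ δ ⊕ ρ) (e' : κ ≃ δ ⊕ τ)

/-- The matrix of rank at most `δ` with leading block `C` whose column space is spanned by
`frame e P` and whose row space is spanned by `frame e' Q`, if `C` is invertible. -/
def chart (P : Matrix ρ δ R) (C : Matrix δ δ R) (Q : Matrix τ δ R) : Matrix ι κ R :=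
  frame e P * C * (frame e' Q)ᵀ

theorem chart_map (P : Matrix ρ δ R) (C : Matrix δ δ R) (Q : Matrix τ δ R) (f : R →+* S) :
    (chart e e' P C Q).map f = chart e e' (P.map f) (C.map f) (Q.map f) := by
  rw [chart, Matrix.map_mul, Matrix.map_mul, Matrix.transpose_map, frame_map, frame_map, chart]

theorem chart_transpose (P : Matrix ρ δ R) (C : Matrix δ δ R) (Q : Matrix τ δ R) :
    (chart e e' P C Q)ᵀ = chart e' e Q Cᵀ P := by
  rw [chart, chart, Matrix.transpose_mul, Matrix.transpose_mul, Matrix.transpose_transpose,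
    Matrix.mul_assoc]

theorem chart_mul_headInclusion [Fintype κ] (P : Matrix ρ δ R) (C : Matrix δ δ R)
    (Q : Matrix τ δ R) :
    chart e e' P C Q * headInclusion R e' = frame e P * C := by
  classical
  rw [chart, Matrix.mul_assoc, ← Matrix.transpose_transpose (headInclusion R e'),
    ← Matrix.transpose_mul, headInclusion_transpose_mul_frame, Matrix.transpose_one, Matrix.mul_one]

theorem chart_apply_inl_inl (P : Matrix ρ δ R) (C : Matrix δ δ R) (Q : Matrix τ δ R) (i j : δ) :
    chart e e' P C Q (e.symm (.inl i)) (e'.symm (.inl j)) = C i j := by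
  classical
  have := Fintype.ofEquiv _ e.symm
  have := Fintype.ofEquiv _ e'.symm
  have hblock : (headInclusion R e)ᵀ * (chart e e' P C Q * headInclusion R e') = C := by
    rw [chart_mul_headInclusion, ← Matrix.mul_assoc, headInclusion_transpose_mul_frame,
      Matrix.one_mul]
  rw [← congrFun₂ hblock i j, headInclusion_transpose_mul]
  exact (mul_headInclusion_apply e' _ _ j).symm

theorem chart_apply_inr_inl (P : Matrix ρ δ R) (C : Matrix δ δ R) (Q : Matrix τ δ R)
    (i : ρ) (j : δ) : chart e e' P C Q (e.symm (.inr i)) (e'.symm (.inl j)) = (P * C) i j := by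
  have := Fintype.ofEquiv _ e.symm
  have := Fintype.ofEquiv _ e'.symm
  have hblock : (tailInclusion R e)ᵀ * (chart e e' P C Q * headInclusion R e') = P * C := by
    rw [chart_mul_headInclusion, ← Matrix.mul_assoc, tailInclusion_transpose_mul_frame]
  rw [← congrFun₂ hblock i j, tailInclusion_transpose_mul]
  exact (mul_headInclusion_apply e' _ _ j).symm

end Chart

theorem eq_map_of_mul_map_eq {F L ρ δ : Type*} [CommRing F] [CommRing L] [Fintype δ]
    [DecidableEq δ] (f : F →+* L) {P : Matrix ρ δ L} {C : Matrix δ δ F} {D : Matrix ρ δ F}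
    (hC : IsUnit C.det) (h : P * C.map f = D.map f) : P = (D * C⁻¹).map f := by
  rw [Matrix.map_mul, ← h, Matrix.mul_assoc, ← Matrix.map_mul, Matrix.mul_nonsing_inv _ hC,
    Matrix.map_one f (map_zero f) (map_one f), Matrix.mul_one]

section Parameters

variable {k L : Type*} [Field k] [Field L] [Algebra k L] (F : IntermediateField k L)

theorem mem_of_forall_mul_mem {ρ δ : Type*} [Fintype δ] [DecidableEq δ] {P : Matrix ρ δ L}
    {C : Matrix δ δ L} (hdet : C.det ≠ 0) (hC : ∀ i j, C i j ∈ F) (hPC : ∀ i j, (P * C) i j ∈ F)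
    (i : ρ) (j : δ) : P i j ∈ F := by
  let C₀ : Matrix δ δ F := Matrix.of fun i j => ⟨C i j, hC i j⟩
  have hdet₀ : C₀.det ≠ 0 := by
    intro h
    refine hdet ((RingHom.map_det (algebraMap F L) C₀).symm.trans ?_)
    rw [h, map_zero]
  rw [eq_map_of_mul_map_eq (algebraMap F L) (P := P) (C := C₀)
    (D := Matrix.of fun i j => ⟨(P * C) i j, hPC i j⟩) hdet₀.isUnit rfl]
  exact SetLike.coe_mem _

theorem parameters_mem_of_chart_mem {ι κ δ ρ τ : Type*} [DecidableEq ι]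
    [DecidableEq κ] [Fintype δ] [DecidableEq δ] [Fintype ρ] [Fintype τ] {e : ι ≃ δ ⊕ ρ}
    {e' : κ ≃ δ ⊕ τ} {P : Matrix ρ δ L} {C : Matrix δ δ L} {Q : Matrix τ δ L} (hdet : C.det ≠ 0)
    (h : ∀ i j, chart e e' P C Q i j ∈ F) :
    (∀ i j, P i j ∈ F) ∧ (∀ i j, C i j ∈ F) ∧ ∀ i j, Q i j ∈ F := by
  have hC (i j) : C i j ∈ F := by
    rw [← chart_apply_inl_inl e e' P C Q]
    exact h _ _
  refine ⟨mem_of_forall_mul_mem F hdet hC fun i j => ?_, hC,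
    mem_of_forall_mul_mem F (C := Cᵀ) (by rwa [Matrix.det_transpose]) (fun i j => hC j i)
      fun i j => ?_⟩
  · rw [← chart_apply_inr_inl e e' P C Q]
    exact h _ _
  · rw [← chart_apply_inr_inl e' e Q Cᵀ P, ← chart_transpose]
    exact h _ _

end Parameters

section Field

variable {k T : Type*} [Field k]

theorem intermediateField_eq_top_of_forall_X_mem
    {F : IntermediateField k (FractionRing (MvPolynomial T k))}
    (h : ∀ t, algebraMap (MvPolynomial T k) _ (MvPolynomial.X t) ∈ F) : F = ⊤ := by
  have hpoly (f : MvPolynomial T k) : algebraMap (MvPolynomial T k) _ f ∈ F := by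
    induction f using MvPolynomial.induction_on with
    | C a =>
      rw [← MvPolynomial.algebraMap_eq, ← IsScalarTower.algebraMap_apply]
      exact F.algebraMap_mem a
    | add p q hp hq => rw [map_add]; exact add_mem hp hq
    | mul_X p t hp => rw [map_mul]; exact mul_mem hp (h t)
  refine eq_top_iff.2 fun x _ => ?_
  obtain ⟨a, b, -, rfl⟩ := IsFractionRing.div_surjective (A := MvPolynomial T k) x
  exact div_mem (hpoly a) (hpoly b)

theorem adjoin_chart_eq_top {ι κ δ ρ τ : Type*} [DecidableEq ι]
    [DecidableEq κ] [Fintype δ] [DecidableEq δ] [Fintype ρ] [Fintype τ] {e : ι ≃ δ ⊕ ρ}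
    {e' : κ ≃ δ ⊕ τ} {P : Matrix ρ δ (MvPolynomial T k)} {C : Matrix δ δ (MvPolynomial T k)}
    {Q : Matrix τ δ (MvPolynomial T k)} (hdet : C.det ≠ 0)
    (hX : ∀ t, (∃ i j, P i j = .X t) ∨ (∃ i j, C i j = .X t) ∨ ∃ i j, Q i j = .X t) :
    IntermediateField.adjoin k (Set.range fun x : ι × κ =>
      algebraMap _ (FractionRing (MvPolynomial T k)) (chart e e' P C Q x.1 x.2)) = ⊤ := by
  set F := IntermediateField.adjoin k (Set.range fun x : ι × κ =>
    algebraMap _ (FractionRing (MvPolynomial T k)) (chart e e' P C Q x.1 x.2))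
  let a := algebraMap (MvPolynomial T k) (FractionRing (MvPolynomial T k))
  have hdet' : (C.map a).det ≠ 0 := by
    rw [← RingHom.mapMatrix_apply, ← RingHom.map_det]
    exact (map_ne_zero_iff _ (IsFractionRing.injective _ _)).2 hdet
  obtain ⟨hP, hC, hQ⟩ := parameters_mem_of_chart_mem F (e := e) (e' := e') (P := P.map a)
    (Q := Q.map a) hdet' fun i j => by
      rw [← chart_map]
      exact IntermediateField.subset_adjoin _ _ ⟨(i, j), rfl⟩
  refine intermediateField_eq_top_of_forall_X_mem fun t => ?_
  rcases hX t with ⟨i, j, h⟩ | ⟨i, j, h⟩ | ⟨i, j, h⟩ <;> rw [← h]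
  exacts [hP i j, hC i j, hQ i j]

theorem vanishingIdeal_eq_ker_aeval {K E : Type*} [Field K] [Algebra k K] [Infinite K]
    {V : Set (E → K)} {φ : E → MvPolynomial T k}
    (hmem : ∀ t : T → K, (fun e => MvPolynomial.aeval t (φ e)) ∈ V)
    (hker : ∀ f : MvPolynomial E k, MvPolynomial.aeval φ f = 0 →
      ∀ x ∈ V, MvPolynomial.aeval x f = 0) :
    MvPolynomial.vanishingIdeal k V = RingHom.ker (MvPolynomial.aeval φ).toRingHom := by
  ext f
  rw [MvPolynomial.mem_vanishingIdeal_iff, RingHom.mem_ker]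
  refine ⟨fun h => ?_, hker f⟩
  refine MvPolynomial.map_injective _ (algebraMap k K).injective (MvPolynomial.funext fun t => ?_)
  rw [map_zero, map_zero, MvPolynomial.eval_map, ← MvPolynomial.aeval_def]
  exact (MvPolynomial.comp_aeval_apply φ (MvPolynomial.aeval t) f).trans (h _ (hmem t))

end Field

section FunctionField

variable {k T : Type*} [Field k] {m n : ℕ}
  {Y : Set (Matrix (Fin m) (Fin n) (AlgebraicClosure k))} {φ : Fin m × Fin n → MvPolynomial T k}

theorem coordinateFunction_separablyAlgebraicallyIndependent_iff {E : Type*} [Finite T] [Fintype E]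
    [(matrixIdeal k Y).IsPrime]
    (hI : matrixIdeal k Y = RingHom.ker (MvPolynomial.aeval φ).toRingHom)
    (hgen : IntermediateField.adjoin k (Set.range fun e =>
      algebraMap _ (FractionRing (MvPolynomial T k)) (φ e)) = ⊤) (x : E → Fin m × Fin n)
    {S : Set E} :
    SeparablyAlgebraicallyIndependent k (fun e : S => coordinateFunction k Y (x e)) ↔
      ContainsNoSupport S (conormalSpace (FractionRing (MvPolynomial T k)) fun e => φ (x e)) := by
  obtain ⟨Φ, hΦ⟩ := exists_algEquiv_functionField hI hgen
  rw [← separablyAlgebraicallyIndependent_algEquiv_iff Φ,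
    ← separablyAlgebraicallyIndependent_iff_containsNoSupport]
  simp only [hΦ]

end FunctionField

/-! ### Rational parametrizations of the varieties of low-rank matrices -/

section Deformation

variable {k K : Type*} [Field k] [Field K] [Algebra k K] {ι κ δ ρ τ : Type*} [DecidableEq ι]
  [Fintype δ] [Fintype ρ]

open Polynomial in
theorem aeval_mul_mul_transpose_eq_zero_of_chart [DecidableEq κ] [Fintype τ]
    {e : ι ≃ δ ⊕ ρ} {e' : κ ≃ δ ⊕ τ} {f : MvPolynomial (ι × κ) k}
    (h : ∀ P C Q, MvPolynomial.aeval (fun x : ι × κ =>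
      (chart e e' P C Q x.1 x.2 : FractionRing K[X])) f = 0)
    (X : Matrix ι δ K) (C : Matrix δ δ K) (Y : Matrix κ δ K) :
    MvPolynomial.aeval (fun x : ι × κ => (X * C * Yᵀ) x.1 x.2) f = 0 := by
  obtain ⟨X, P, G, rfl, hX⟩ := exists_eval_zero_eq_and_eq_frame_mul e X
  obtain ⟨Y, Q, H, rfl, hY⟩ := exists_eval_zero_eq_and_eq_frame_mul e' Y
  refine aeval_mul_mul_transpose_eq_zero X C Y ?_
  have hchart := h P (G * C.map (algebraMap _ _) * Hᵀ) Q
  simpa only [chart, hX, hY, Matrix.transpose_mul, Matrix.mul_assoc] using hchart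

open Polynomial in
theorem HasSymmetry.aeval_mul_mul_transpose_eq_zero_of_chart {s : Symmetry} {e : ι ≃ δ ⊕ ρ}
    {f : MvPolynomial (ι × ι) k}
    (h : ∀ P C, HasSymmetry s C → MvPolynomial.aeval (fun x : ι × ι =>
      (chart e e P C P x.1 x.2 : FractionRing K[X])) f = 0)
    (X : Matrix ι δ K) {C : Matrix δ δ K} (hC : HasSymmetry s C) :
    MvPolynomial.aeval (fun x : ι × ι => (X * C * Xᵀ) x.1 x.2) f = 0 := by
  obtain ⟨X, P, G, rfl, hX⟩ := exists_eval_zero_eq_and_eq_frame_mul e X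
  refine aeval_mul_mul_transpose_eq_zero X C X ?_
  have hchart := h P (G * C.map (algebraMap _ _) * Gᵀ) ((hC.map _).mul_mul_transpose G)
  simpa only [chart, hX, Matrix.transpose_mul, Matrix.mul_assoc] using hchart

end Deformation

section RankLocus

variable {R ι κ δ ρ τ : Type*} [CommRing R] [DecidableEq ι] [DecidableEq κ]
  [Fintype δ] [Fintype ρ] [Fintype τ]

/-- The index set of the free entries of the matrices `C`, `P` and `Q` in `chart e e' P C Q`. -/
abbrev RankParameter (δ ρ τ : Type*) : Type _ := (δ × δ) ⊕ ((ρ × δ) ⊕ (τ × δ))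

/-- The parametrization of the matrices of rank at most `δ` by the matrices `chart e e' P C Q`. -/
def rankChart (e : ι ≃ δ ⊕ ρ) (e' : κ ≃ δ ⊕ τ) (t : RankParameter δ ρ τ → R) : Matrix ι κ R :=
  chart e e' (.of fun i j => t (.inr (.inl (i, j)))) (.of fun i j => t (.inl (i, j)))
    (.of fun i j => t (.inr (.inr (i, j))))

theorem chart_mem_range_rankChart (e : ι ≃ δ ⊕ ρ) (e' : κ ≃ δ ⊕ τ) (P : Matrix ρ δ R)
    (C : Matrix δ δ R) (Q : Matrix τ δ R) : chart e e' P C Q ∈ Set.range (rankChart e e') :=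
  ⟨Sum.elim (fun x => C x.1 x.2) (Sum.elim (fun x => P x.1 x.2) fun x => Q x.1 x.2), rfl⟩

theorem aeval_rankChart_X {k : Type*} [CommRing k] [Algebra k R] (e : ι ≃ δ ⊕ ρ) (e' : κ ≃ δ ⊕ τ)
    (t : RankParameter δ ρ τ → R) (i : ι) (j : κ) :
    MvPolynomial.aeval t (rankChart e e' (MvPolynomial.X (R := k)) i j) = rankChart e e' t i j := by
  refine (congrFun₂ (chart_map e e' (R := MvPolynomial (RankParameter δ ρ τ) k) _ _ _
    (MvPolynomial.aeval t).toRingHom) i j).trans ?_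
  simp only [rankChart, Matrix.map, Matrix.of_apply, AlgHom.toRingHom_eq_coe, RingHom.coe_coe,
    MvPolynomial.aeval_X]

variable (k : Type*) [Field k] {m n d : ℕ}

theorem matrixIdeal_rankLocus (e : Fin m ≃ Fin d ⊕ ρ) (e' : Fin n ≃ Fin d ⊕ τ) :
    matrixIdeal k (rankLocus (AlgebraicClosure k) m n d) =
      RingHom.ker (MvPolynomial.aeval fun x : Fin m × Fin n =>
        rankChart e e' (MvPolynomial.X (R := k)) x.1 x.2).toRingHom := by
  refine vanishingIdeal_eq_ker_aeval
    (fun t => ⟨rankChart e e' t, rank_mul_mul_le _ _ _, ?_⟩) ?_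
  · simp only [aeval_rankChart_X]
  · rintro f hf _ ⟨A, hA, rfl⟩
    obtain ⟨X, C, Y, rfl⟩ := exists_eq_mul_mul_transpose_of_rank_le hA
    refine aeval_mul_mul_transpose_eq_zero_of_chart (e := e) (e' := e') (fun P C Q => ?_) X C Y
    obtain ⟨t, ht⟩ := chart_mem_range_rankChart e e' P C Q
    have := congrArg (MvPolynomial.aeval t) hf
    rw [map_zero, MvPolynomial.comp_aeval_apply] at this
    simpa only [aeval_rankChart_X, ht] using this

end RankLocus

section SymmetryRankLocus

variable {R ι δ ρ : Type*} [CommRing R] [DecidableEq ι] [Fintype ρ] {s : Symmetry}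
  {d : ℕ}

/-- The matrices of symmetry type `s` of rank at most `d`. -/
def symmetryRankLocus (s : Symmetry) (R : Type*) [Field R] (n d : ℕ) :
    Set (Matrix (Fin n) (Fin n) R) :=
  {A | HasSymmetry s A ∧ A.rank ≤ d}

theorem symmetryRankLocus_symmetric (R : Type*) [Field R] (n d : ℕ) :
    symmetryRankLocus .symmetric R n d = symRankLocus R n d :=
  Set.ext fun _ => and_congr_left fun _ => hasSymmetry_symmetric_iff

theorem symmetryRankLocus_alternating (R : Type*) [Field R] (n d : ℕ) :
    symmetryRankLocus .alternating R n d = skewRankLocus R n d :=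
  Set.ext fun _ => (and_congr_left fun _ => hasSymmetry_alternating_iff).trans and_assoc

/-- The index set of the free entries of the matrices `C` and `P` in `chart e e P C P`, where `C` is
of symmetry type `s`. -/
abbrev SymmetryParameter (s : Symmetry) (d : ℕ) (ρ : Type*) : Type _ :=
  EntryIndex s d ⊕ (ρ × Fin d)

/-- The parametrization of the matrices of symmetry type `s` and rank at most `d` by the matrices
`chart e e P C P`. -/
def symmetryChart (e : ι ≃ Fin d ⊕ ρ) (t : SymmetryParameter s d ρ → R) : Matrix ι ι R :=
  chart e e (.of fun i j => t (.inr (i, j))) (ofEntries s fun x => t (.inl x))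
    (.of fun i j => t (.inr (i, j)))

theorem HasSymmetry.chart_mem_range_symmetryChart (e : ι ≃ Fin d ⊕ ρ) (P : Matrix ρ (Fin d) R)
    {C : Matrix (Fin d) (Fin d) R} (hC : HasSymmetry s C) :
    chart e e P C P ∈ Set.range (symmetryChart (s := s) e) :=
  ⟨Sum.elim (fun x => C x.1.1 x.1.2) fun x => P x.1 x.2,
    congrArg (chart e e P · P) hC.ofEntries_eq⟩

theorem aeval_symmetryChart_X {k : Type*} [CommRing k] [Algebra k R] (e : ι ≃ Fin d ⊕ ρ)
    (t : SymmetryParameter s d ρ → R) (i j : ι) :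
    MvPolynomial.aeval t (symmetryChart e (MvPolynomial.X (R := k)) i j) =
      symmetryChart e t i j := by
  refine (congrFun₂ (chart_map e e (R := MvPolynomial (SymmetryParameter s d ρ) k) _ _ _
    (MvPolynomial.aeval t).toRingHom) i j).trans ?_
  rw [ofEntries_map]
  simp only [symmetryChart, Matrix.map, Matrix.of_apply, AlgHom.toRingHom_eq_coe,
    RingHom.coe_coe, MvPolynomial.aeval_X]

variable (k : Type*) [Field k] {n : ℕ}

theorem matrixIdeal_symmetryRankLocus (e : Fin n ≃ Fin d ⊕ ρ) :
    matrixIdeal k (symmetryRankLocus s (AlgebraicClosure k) n d) =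
      RingHom.ker (MvPolynomial.aeval fun x : Fin n × Fin n =>
        symmetryChart (s := s) e (MvPolynomial.X (R := k)) x.1 x.2).toRingHom := by
  refine vanishingIdeal_eq_ker_aeval (fun t => ⟨symmetryChart e t,
    ⟨(hasSymmetry_ofEntries _).mul_mul_transpose _, rank_mul_mul_le _ _ _⟩, ?_⟩) ?_
  · simp only [aeval_symmetryChart_X]
  · rintro f hf _ ⟨A, ⟨hA, hrank⟩, rfl⟩
    obtain ⟨X, C, hC, rfl⟩ := hA.exists_eq_mul_mul_transpose_of_rank_le hrank
    refine HasSymmetry.aeval_mul_mul_transpose_eq_zero_of_chart (e := e) (fun P C hC => ?_) X hC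
    obtain ⟨t, ht⟩ := hC.chart_mem_range_symmetryChart e P
    have := congrArg (MvPolynomial.aeval t) hf
    rw [map_zero, MvPolynomial.comp_aeval_apply] at this
    simpa only [aeval_symmetryChart_X, ht] using this

end SymmetryRankLocus

/-! ### Conormal spaces of the varieties of low-rank matrices -/

section Derivation

variable {k R L : Type*} [CommRing k] [CommRing R] [CommRing L] [Algebra k R] [Algebra R L]
  [Algebra k L] {ι κ σ δ ρ τ : Type*} (D : Derivation k R L)

theorem map_derivation_mul [Fintype κ] (A : Matrix ι κ R) (B : Matrix κ σ R) :
    (A * B).map D = A.map D * B.map (algebraMap R L) + A.map (algebraMap R L) * B.map D := by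
  ext i j
  simp only [Matrix.map_apply, Matrix.mul_apply, Matrix.add_apply, map_sum, Derivation.leibniz,
    Algebra.smul_def, ← Finset.sum_add_distrib]
  exact Finset.sum_congr rfl fun x _ => by ring

variable [DecidableEq ι] [DecidableEq κ] [Fintype ρ] [Fintype τ] (e : ι ≃ δ ⊕ ρ) (e' : κ ≃ δ ⊕ τ)

theorem frame_map_derivation (P : Matrix ρ δ R) :
    (frame e P).map D = tailInclusion L e * P.map D := by
  have hone (i j : ι) : D ((1 : Matrix ι ι R) i j) = 0 := by
    rw [Matrix.one_apply, apply_ite D, D.map_one_eq_zero, map_zero, ite_self]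
  have hhead : (headInclusion R e).map D = 0 := Matrix.ext fun _ _ => hone _ _
  have htail : (tailInclusion R e).map D = 0 := Matrix.ext fun _ _ => hone _ _
  rw [frame, Matrix.map_add D (map_add D), map_derivation_mul, hhead, htail, Matrix.zero_mul,
    zero_add, zero_add, tailInclusion_map]

theorem chart_map_derivation [Fintype δ] (P : Matrix ρ δ R) (C : Matrix δ δ R)
    (Q : Matrix τ δ R) :
    (chart e e' P C Q).map D =
      (tailInclusion L e * P.map D * C.map (algebraMap R L) +
          frame e (P.map (algebraMap R L)) * C.map D) * (frame e' (Q.map (algebraMap R L)))ᵀ +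
        frame e (P.map (algebraMap R L)) * C.map (algebraMap R L) *
          (tailInclusion L e' * Q.map D)ᵀ := by
  rw [chart, map_derivation_mul, map_derivation_mul, Matrix.map_mul, Matrix.transpose_map,
    Matrix.transpose_map, frame_map_derivation, frame_map_derivation, frame_map, frame_map]

end Derivation

section Coframe

variable {L ι κ δ ρ τ : Type*} [CommRing L] [DecidableEq ι] [Fintype κ] [DecidableEq κ]
  [Fintype δ] [Fintype ρ] [Fintype τ]

theorem coframe_mul_mul_coframe_transpose_mul_frame {e : ι ≃ δ ⊕ ρ} {e' : κ ≃ δ ⊕ τ}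
    {P : Matrix ρ δ L} {Q : Matrix τ δ L} (B : Matrix ρ τ L) :
    coframe e P * B * (coframe e' Q)ᵀ * frame e' Q = 0 := by
  rw [Matrix.mul_assoc, ← Matrix.transpose_transpose (frame e' Q), ← Matrix.transpose_mul,
    frame_transpose_mul_coframe, Matrix.transpose_zero, Matrix.mul_zero]

variable [Fintype ι] {e : ι ≃ δ ⊕ ρ} {e' : κ ≃ δ ⊕ τ} {P : Matrix ρ δ L} {Q : Matrix τ δ L}

theorem eq_coframe_mul_mul_coframe_transpose {N : Matrix ι κ L} (hX : (frame e P)ᵀ * N = 0)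
    (hY : N * frame e' Q = 0) :
    N = coframe e P * ((tailInclusion L e)ᵀ * N * tailInclusion L e') * (coframe e' Q)ᵀ := by
  have htranspose : Nᵀ = coframe e' Q * ((tailInclusion L e')ᵀ * Nᵀ) :=
    eq_coframe_mul_of_frame_transpose_mul_eq_zero e' (by
      rw [← Matrix.transpose_mul, hY, Matrix.transpose_zero])
  have hN : N = N * tailInclusion L e' * (coframe e' Q)ᵀ := by
    rw [← Matrix.transpose_inj, Matrix.transpose_mul, Matrix.transpose_mul,
      Matrix.transpose_transpose, ← htranspose]
  conv_lhs => rw [eq_coframe_mul_of_frame_transpose_mul_eq_zero e hX, hN]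
  simp only [Matrix.mul_assoc]

theorem mem_productEntries_coframe_iff {c : ι × κ → L} :
    c ∈ productEntries (coframe e P) (coframe e' Q) ↔
      (frame e P)ᵀ * (Matrix.of fun i j => c (i, j)) = 0 ∧
        (Matrix.of fun i j => c (i, j)) * frame e' Q = 0 := by
  constructor
  · rintro ⟨B, rfl⟩
    refine ⟨?_, coframe_mul_mul_coframe_transpose_mul_frame B⟩
    change (frame e P)ᵀ * (coframe e P * B * (coframe e' Q)ᵀ) = 0
    rw [← Matrix.mul_assoc, ← Matrix.mul_assoc, frame_transpose_mul_coframe, Matrix.zero_mul,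
      Matrix.zero_mul]
  · rintro ⟨hX, hY⟩
    exact ⟨_, funext fun x => (congrFun₂ (eq_coframe_mul_mul_coframe_transpose hX hY) x.1 x.2).symm⟩

theorem mem_symmetryProductEntries_coframe_iff {n : ℕ} {s : Symmetry} {e : Fin n ≃ δ ⊕ ρ}
    {c : EntryIndex s n → L} :
    c ∈ symmetryProductEntries s (coframe e P) ↔ ofEntries s c * frame e P = 0 := by
  constructor
  · rintro ⟨B, hB, rfl⟩
    rw [HasSymmetry.ofEntries_eq (hB.mul_mul_transpose _)]
    exact coframe_mul_mul_coframe_transpose_mul_frame B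
  · intro hY
    have hsymm := hasSymmetry_ofEntries c
    have hX : (frame e P)ᵀ * ofEntries s c = 0 := by
      rw [← Matrix.transpose_inj, Matrix.transpose_mul, Matrix.transpose_transpose,
        hsymm.transpose_eq, Matrix.smul_mul, hY, smul_zero, Matrix.transpose_zero]
    refine ⟨_, ?_, funext fun x =>
      (congrFun₂ (eq_coframe_mul_mul_coframe_transpose hX hY) _ _).symm.trans
        (ofEntries_apply c x)⟩
    simpa only [Set.mem_ofPred_eq, Matrix.transpose_transpose] using
      hsymm.mul_mul_transpose (tailInclusion L e)ᵀ

end Coframe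

section Tangent

variable {L ι κ δ ρ τ : Type*} [CommRing L] [Fintype δ]

theorem exists_eq_tailInclusion_mul_add_frame_mul [DecidableEq ι] [DecidableEq δ]
    [Fintype ρ] (e : ι ≃ δ ⊕ ρ) (P : Matrix ρ δ L) {C : Matrix δ δ L} (hC : IsUnit C.det)
    (W : Matrix ι δ L) :
    ∃ (P' : Matrix ρ δ L) (C' : Matrix δ δ L), W = tailInclusion L e * P' * C + frame e P * C' := by
  have := Fintype.ofEquiv _ e.symm
  refine ⟨((tailInclusion L e)ᵀ * W - P * ((headInclusion L e)ᵀ * W)) * C⁻¹,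
    (headInclusion L e)ᵀ * W, ?_⟩
  rw [Matrix.mul_assoc, Matrix.nonsing_inv_mul_cancel_right _ _ hC, frame, Matrix.add_mul,
    Matrix.mul_sub, Matrix.mul_assoc _ P]
  conv_lhs => rw [eq_headInclusion_mul_add_tailInclusion_mul L e W]
  abel

variable [Fintype ι] [Fintype κ]

theorem sum_mul_eq_trace (N M : Matrix ι κ L) :
    ∑ x : ι × κ, N x.1 x.2 * M x.1 x.2 = (N * Mᵀ).trace :=
  Fintype.sum_prod_type _

theorem forall_trace_mul_transpose_mul_transpose_eq_zero_iff {Y : Matrix κ δ L}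
    {N : Matrix ι κ L} : (∀ W : Matrix ι δ L, (N * (W * Yᵀ)ᵀ).trace = 0) ↔ N * Y = 0 := by
  rw [Matrix.ext_iff_trace_mul_right]
  simp only [Matrix.transpose_mul, Matrix.transpose_transpose, ← Matrix.mul_assoc, Matrix.zero_mul,
    Matrix.trace_zero]
  exact ⟨fun h W => h Wᵀ, fun h W => h Wᵀ⟩

theorem forall_trace_mul_mul_transpose_transpose_eq_zero_iff {X : Matrix ι δ L}
    {N : Matrix ι κ L} : (∀ W : Matrix κ δ L, (N * (X * Wᵀ)ᵀ).trace = 0) ↔ Xᵀ * N = 0 := by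
  rw [Matrix.ext_iff_trace_mul_right]
  simp only [Matrix.transpose_mul, Matrix.transpose_transpose, ← Matrix.mul_assoc, Matrix.zero_mul,
    Matrix.trace_zero, Matrix.trace_mul_comm _ Xᵀ]

theorem forall_trace_mul_chartTangent_eq_zero_iff [DecidableEq ι] [DecidableEq κ] [DecidableEq δ]
    [Fintype ρ] [Fintype τ] {e : ι ≃ δ ⊕ ρ} {e' : κ ≃ δ ⊕ τ} {P : Matrix ρ δ L} {C : Matrix δ δ L}
    {Q : Matrix τ δ L} (hC : IsUnit C.det) {N : Matrix ι κ L} :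
    (∀ (P' : Matrix ρ δ L) (C' : Matrix δ δ L) (Q' : Matrix τ δ L),
      (N * ((tailInclusion L e * P' * C + frame e P * C') * (frame e' Q)ᵀ +
        frame e P * C * (tailInclusion L e' * Q')ᵀ)ᵀ).trace = 0) ↔
      (frame e P)ᵀ * N = 0 ∧ N * frame e' Q = 0 := by
  rw [← forall_trace_mul_mul_transpose_transpose_eq_zero_iff,
    ← forall_trace_mul_transpose_mul_transpose_eq_zero_iff]
  refine ⟨fun h => ⟨fun W => ?_, fun W => ?_⟩, fun ⟨hX, hY⟩ P' C' Q' => ?_⟩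
  · obtain ⟨Q', C', rfl⟩ := exists_eq_tailInclusion_mul_add_frame_mul e' Q (C := Cᵀ)
      (by rwa [Matrix.det_transpose]) W
    rw [← h 0 C'ᵀ Q', add_comm]
    simp only [Matrix.transpose_add, Matrix.transpose_mul, Matrix.transpose_transpose,
      Matrix.mul_zero, Matrix.zero_mul, zero_add, Matrix.mul_add, Matrix.mul_assoc]
  · obtain ⟨P', C', rfl⟩ := exists_eq_tailInclusion_mul_add_frame_mul e P hC W
    rw [← h P' C' 0, Matrix.mul_zero, Matrix.transpose_zero, Matrix.mul_zero, add_zero]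
  · have hQ' := hX (tailInclusion L e' * Q' * Cᵀ)
    rw [Matrix.transpose_mul _ Cᵀ, Matrix.transpose_transpose, ← Matrix.mul_assoc] at hQ'
    rw [Matrix.transpose_add, Matrix.mul_add, Matrix.trace_add, hY, hQ', add_zero]

end Tangent

section ConormalSpace

variable {k L T ι κ : Type*} [Field k] [Field L] [Algebra k L] [Algebra (MvPolynomial T k) L]
  [IsScalarTower k (MvPolynomial T k) L]

theorem mem_conormalSpace_iff_trace [Fintype ι] [Fintype κ] {M : Matrix ι κ (MvPolynomial T k)}
    {c : ι × κ → L} :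
    c ∈ conormalSpace L (fun x : ι × κ => M x.1 x.2) ↔
      ∀ w, (Matrix.of (Function.curry c) * (M.map (MvPolynomial.mkDerivation k w))ᵀ).trace = 0 :=
  forall_congr' fun w => by
    have := sum_mul_eq_trace (Matrix.of (Function.curry c)) (M.map (MvPolynomial.mkDerivation k w))
    exact iff_of_eq (congrArg (· = 0) this)

variable {δ ρ τ : Type*} [DecidableEq ι] [DecidableEq κ] [Fintype δ] [Fintype ρ] [Fintype τ]
  [Algebra (MvPolynomial (RankParameter δ ρ τ) k) L]
  [IsScalarTower k (MvPolynomial (RankParameter δ ρ τ) k) L]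

theorem rankChart_map_mkDerivation (e : ι ≃ δ ⊕ ρ) (e' : κ ≃ δ ⊕ τ) (w : RankParameter δ ρ τ → L) :
    (rankChart e e' (MvPolynomial.X (R := k))).map (MvPolynomial.mkDerivation k w) =
      let ξ (t : RankParameter δ ρ τ) : L := algebraMap (MvPolynomial _ k) L (.X t)
      (tailInclusion L e * (Matrix.of fun i j => w (.inr (.inl (i, j)))) *
            (Matrix.of fun i j => ξ (.inl (i, j))) +
          frame e (Matrix.of fun i j => ξ (.inr (.inl (i, j)))) *
            (Matrix.of fun i j => w (.inl (i, j)))) *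
          (frame e' (Matrix.of fun i j => ξ (.inr (.inr (i, j)))))ᵀ +
        frame e (Matrix.of fun i j => ξ (.inr (.inl (i, j)))) *
            (Matrix.of fun i j => ξ (.inl (i, j))) *
          (tailInclusion L e' * (Matrix.of fun i j => w (.inr (.inr (i, j)))))ᵀ := by
  rw [rankChart, chart_map_derivation]
  simp only [Matrix.map, Matrix.of_apply, MvPolynomial.mkDerivation_X]

variable [Fintype ι] [Fintype κ] [DecidableEq δ]

theorem conormalSpace_rankChart (e : ι ≃ δ ⊕ ρ) (e' : κ ≃ δ ⊕ τ) {ξ : RankParameter δ ρ τ → L}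
    (hξ : ∀ t, algebraMap (MvPolynomial (RankParameter δ ρ τ) k) L (.X t) = ξ t)
    (hdet : (Matrix.of fun i j => ξ (.inl (i, j))).det ≠ 0) :
    conormalSpace L (fun x : ι × κ => rankChart e e' (MvPolynomial.X (R := k)) x.1 x.2) =
      productEntries (coframe e (.of fun i j => ξ (.inr (.inl (i, j)))))
        (coframe e' (.of fun i j => ξ (.inr (.inr (i, j))))) := by
  obtain rfl := funext hξ
  ext c
  rw [mem_conormalSpace_iff_trace, mem_productEntries_coframe_iff,
    ← forall_trace_mul_chartTangent_eq_zero_iff hdet.isUnit]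
  simp only [rankChart_map_mkDerivation]
  exact ⟨fun h P C Q => h (Sum.elim (fun x => C x.1 x.2)
    (Sum.elim (fun x => P x.1 x.2) fun x => Q x.1 x.2)), fun h w => h _ _ _⟩

end ConormalSpace

/-! ### Conormal spaces in the presence of a symmetry type -/

section Symmetrization

variable {R ι : Type*} [CommRing R] {s : Symmetry}

theorem hasSymmetry_add_sign_smul_transpose (s : Symmetry) (W : Matrix ι ι R) :
    HasSymmetry s (W + s.sign R • Wᵀ) := by
  refine ⟨?_, ?_⟩
  · rw [smul_add, smul_smul, Symmetry.sign_mul_self, one_smul, Matrix.transpose_add,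
      Matrix.transpose_smul, Matrix.transpose_transpose, add_comm]
  · rintro rfl i
    simp [Symmetry.sign]

theorem HasSymmetry.exists_eq_add_sign_smul_transpose {K : Type*} [Field K] [LinearOrder ι]
    (hs : s = .symmetric → (2 : K) ≠ 0) {M : Matrix ι ι K} (h : HasSymmetry s M) :
    ∃ W : Matrix ι ι K, M = W + s.sign K • Wᵀ := by
  cases s with
  | symmetric =>
    have htwo := hs rfl
    refine ⟨(2 : K)⁻¹ • M, ?_⟩
    rw [Matrix.transpose_smul, h.transpose_eq, Symmetry.sign, one_smul, one_smul, ← add_smul,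
      ← two_mul, mul_inv_cancel₀ htwo, one_smul]
  | alternating =>
    refine ⟨.of fun i j => if i < j then M i j else 0, ?_⟩
    ext i j
    rcases lt_trichotomy i j with hij | rfl | hij
    · simp [hij, hij.not_gt]
    · simp [h.diag_eq_zero rfl]
    · simp [hij, hij.not_gt, h.apply_swap j i]

/-- The weights of the free entries in `sum_mul_add_sign_smul_transpose`: the diagonal entries of
`Z + Zᵀ` are twice those of `Z`. -/
def diagonalWeight (R : Type*) [CommRing R] {n : ℕ} (x : EntryIndex s n) : R :=
  if x.1.1 = x.1.2 then 2 else 1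

theorem diagonalWeight_ne_zero [Nontrivial R] (hs : s = .symmetric → (2 : R) ≠ 0) {n : ℕ}
    (x : EntryIndex s n) : diagonalWeight R x ≠ 0 := by
  obtain ⟨⟨i, j⟩, hij⟩ := x
  rw [diagonalWeight]
  split_ifs with h
  · obtain rfl : i = j := h
    exact hs hij.eq_symmetric
  · exact one_ne_zero

theorem sum_mul_add_sign_smul_transpose {n : ℕ} (c : EntryIndex s n → R)
    (Z : Matrix (Fin n) (Fin n) R) :
    ∑ x, c x * (Z + s.sign R • Zᵀ) x.1.1 x.1.2 =
      (ofEntries s (diagonalWeight R * c) * Zᵀ).trace := by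
  let U : Matrix (Fin n) (Fin n) R :=
    .of fun i j => if h : s.EntryRel i j then c ⟨(i, j), h⟩ else 0
  have hU : ofEntries s (diagonalWeight R * c) = U + s.sign R • Uᵀ := by
    refine (hasSymmetry_ofEntries _).ext (hasSymmetry_add_sign_smul_transpose s U) ?_
    rintro ⟨⟨i, j⟩, hij⟩
    rw [ofEntries_apply]
    by_cases h : i = j
    · obtain rfl := h
      obtain rfl : s = .symmetric := hij.eq_symmetric
      simp [U, diagonalWeight, Symmetry.sign, hij, two_mul]
    · have hji : ¬ s.EntryRel j i := fun hji => h (le_antisymm hij.le hji.le)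
      simp [U, diagonalWeight, h, hij, hji]
  have hsum (M : Matrix (Fin n) (Fin n) R) :
      ∑ x : EntryIndex s n, c x * M x.1.1 x.1.2 = (U * Mᵀ).trace := by
    rw [← sum_mul_eq_trace]
    refine Fintype.sum_of_injective Subtype.val Subtype.val_injective _ _ (fun x hx => ?_)
      fun x => ?_
    · have hx : ¬ s.EntryRel x.1 x.2 := by simpa using hx
      simp [U, hx]
    · simp [U, x.2]
  rw [hsum, hU, Matrix.transpose_add, Matrix.transpose_smul, Matrix.transpose_transpose,
    Matrix.mul_add, Matrix.mul_smul, Matrix.add_mul, Matrix.smul_mul, Matrix.trace_add,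
    Matrix.trace_add, Matrix.trace_smul, Matrix.trace_smul, ← Matrix.trace_transpose (U * Z),
    Matrix.transpose_mul, Matrix.trace_mul_comm Zᵀ]

end Symmetrization

section SymmetryChart

variable {L ρ : Type*} [Field L] [Fintype ρ] {s : Symmetry} {n d : ℕ} {e : Fin n ≃ Fin d ⊕ ρ}
  {P : Matrix ρ (Fin d) L} {C : Matrix (Fin d) (Fin d) L}

theorem HasSymmetry.symmetryChartTangent_eq (hC : HasSymmetry s C) (P' : Matrix ρ (Fin d) L)
    (W : Matrix (Fin d) (Fin d) L) :
    (tailInclusion L e * P' * C + frame e P * (W + s.sign L • Wᵀ)) * (frame e P)ᵀ +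
        frame e P * C * (tailInclusion L e * P')ᵀ =
      (tailInclusion L e * P' * C + frame e P * W) * (frame e P)ᵀ +
        s.sign L • ((tailInclusion L e * P' * C + frame e P * W) * (frame e P)ᵀ)ᵀ := by
  simp only [Matrix.transpose_mul, Matrix.transpose_add, Matrix.transpose_transpose,
    hC.transpose_eq, Matrix.mul_add, Matrix.add_mul, smul_add, Matrix.smul_mul, Matrix.mul_smul,
    smul_smul, Symmetry.sign_mul_self, one_smul, Matrix.mul_assoc]
  abel

theorem HasSymmetry.forall_sum_mul_symmetryChartTangent_eq_zero_iff
    (hs : s = .symmetric → (2 : L) ≠ 0) (hC : HasSymmetry s C) (hdet : C.det ≠ 0)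
    {c : EntryIndex s n → L} :
    (∀ (P' : Matrix ρ (Fin d) L) (C' : Matrix (Fin d) (Fin d) L), HasSymmetry s C' →
      ∑ x, c x * ((tailInclusion L e * P' * C + frame e P * C') * (frame e P)ᵀ +
        frame e P * C * (tailInclusion L e * P')ᵀ) x.1.1 x.1.2 = 0) ↔
      ofEntries s (diagonalWeight L * c) * frame e P = 0 := by
  rw [← forall_trace_mul_transpose_mul_transpose_eq_zero_iff]
  constructor
  · intro h W
    obtain ⟨P', W', rfl⟩ := exists_eq_tailInclusion_mul_add_frame_mul e P hdet.isUnit W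
    rw [← sum_mul_add_sign_smul_transpose, ← hC.symmetryChartTangent_eq]
    exact h _ _ (hasSymmetry_add_sign_smul_transpose s W')
  · rintro h P' C' hC'
    obtain ⟨W', rfl⟩ := hC'.exists_eq_add_sign_smul_transpose hs
    rw [hC.symmetryChartTangent_eq, sum_mul_add_sign_smul_transpose]
    exact h _

variable {k : Type*} [Field k] [Algebra k L] [Algebra (MvPolynomial (SymmetryParameter s d ρ) k) L]
  [IsScalarTower k (MvPolynomial (SymmetryParameter s d ρ) k) L]

theorem symmetryChart_map_mkDerivation (w : SymmetryParameter s d ρ → L) :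
    (symmetryChart (s := s) e (MvPolynomial.X (R := k))).map (MvPolynomial.mkDerivation k w) =
      let ξ (t : SymmetryParameter s d ρ) : L := algebraMap (MvPolynomial _ k) L (.X t)
      (tailInclusion L e * (Matrix.of fun i j => w (.inr (i, j))) *
            (ofEntries s fun x => ξ (.inl x)) +
          frame e (Matrix.of fun i j => ξ (.inr (i, j))) * (ofEntries s fun x => w (.inl x))) *
          (frame e (Matrix.of fun i j => ξ (.inr (i, j))))ᵀ +
        frame e (Matrix.of fun i j => ξ (.inr (i, j))) * (ofEntries s fun x => ξ (.inl x)) *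
          (tailInclusion L e * (Matrix.of fun i j => w (.inr (i, j))))ᵀ := by
  rw [symmetryChart, chart_map_derivation, ofEntries_map, ofEntries_map]
  simp only [Matrix.map, Matrix.of_apply, MvPolynomial.mkDerivation_X]

theorem mem_conormalSpace_symmetryChart_iff (hs : s = .symmetric → (2 : L) ≠ 0)
    {ξ : SymmetryParameter s d ρ → L}
    (hξ : ∀ t, algebraMap (MvPolynomial (SymmetryParameter s d ρ) k) L (.X t) = ξ t)
    (hdet : (ofEntries s fun x => ξ (.inl x)).det ≠ 0) {c : EntryIndex s n → L} :
    c ∈ conormalSpace L (fun x : EntryIndex s n =>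
        symmetryChart (s := s) e (MvPolynomial.X (R := k)) x.1.1 x.1.2) ↔
      diagonalWeight L * c ∈
        symmetryProductEntries s (coframe e (.of fun i j => ξ (.inr (i, j)))) := by
  obtain rfl := funext hξ
  rw [mem_symmetryProductEntries_coframe_iff,
    ← (hasSymmetry_ofEntries _).forall_sum_mul_symmetryChartTangent_eq_zero_iff hs hdet]
  have htangent (w : SymmetryParameter s d ρ → L) (i j : Fin n) :
      MvPolynomial.mkDerivation k w (symmetryChart (s := s) e MvPolynomial.X i j) = _ :=
    congrFun₂ (symmetryChart_map_mkDerivation w) i j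
  simp only [conormalSpace, Set.mem_ofPred_eq, htangent]
  refine ⟨fun h P' C' hC' => ?_, fun h w => h _ _ (hasSymmetry_ofEntries _)⟩
  rw [← hC'.ofEntries_eq]
  exact h (Sum.elim (fun x => C' x.1.1 x.1.2) fun x => P' x.1 x.2)

theorem containsNoSupport_conormalSpace_symmetryChart_iff (hs : s = .symmetric → (2 : L) ≠ 0)
    {ξ : SymmetryParameter s d ρ → L}
    (hξ : ∀ t, algebraMap (MvPolynomial (SymmetryParameter s d ρ) k) L (.X t) = ξ t)
    (hdet : (ofEntries s fun x => ξ (.inl x)).det ≠ 0) {S : Set (EntryIndex s n)} :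
    ContainsNoSupport S (conormalSpace L fun x : EntryIndex s n =>
        symmetryChart (s := s) e (MvPolynomial.X (R := k)) x.1.1 x.1.2) ↔
      ContainsNoSupport S
        (symmetryProductEntries s (coframe e (.of fun i j => ξ (.inr (i, j))))) := by
  have hweight := diagonalWeight_ne_zero (n := n) hs
  exact containsNoSupport_iff_of_mul_mem_iff hweight
    (fun c => mem_conormalSpace_symmetryChart_iff hs hξ hdet)
    fun c _ => ⟨(diagonalWeight L)⁻¹ * c, by
      rw [← mul_assoc]
      ext x
      simp [hweight x]⟩

end SymmetryChart

/-! ### Generic matrices -/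

section GenericDeterminant

variable {R A : Type*} [CommRing R] [CommRing A] [Algebra R A]

theorem det_ne_zero_of_algebraicIndependent [Nontrivial R] {ι : Type*} [Fintype ι] [DecidableEq ι]
    {M : Matrix ι ι A} (h : AlgebraicIndependent R fun x : ι × ι => M x.1 x.2) : M.det ≠ 0 := by
  rw [← Matrix.mvPolynomialX_mapMatrix_aeval R M, ← AlgHom.map_det]
  exact fun hdet => Matrix.det_mvPolynomialX_ne_zero ι R (h (hdet.trans (map_zero _).symm))

theorem aeval_det_ofEntries_X {s : Symmetry} {n : ℕ} (x : EntryIndex s n → A) :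
    MvPolynomial.aeval x (ofEntries s (MvPolynomial.X (R := R))).det = (ofEntries s x).det := by
  rw [AlgHom.map_det, AlgHom.mapMatrix_apply, ofEntries_map]
  simp only [MvPolynomial.aeval_X]

theorem HasSymmetry.det_ofEntries_ne_zero_of_algebraicIndependent {s : Symmetry} {n : ℕ}
    {M : Matrix (Fin n) (Fin n) R} (hM : HasSymmetry s M) (hdet : M.det ≠ 0)
    {x : EntryIndex s n → A} (hx : AlgebraicIndependent R x) : (ofEntries s x).det ≠ 0 := by
  rw [← aeval_det_ofEntries_X (R := R)]
  intro h
  have hX : (ofEntries s (MvPolynomial.X (R := R) (σ := EntryIndex s n))).det = 0 :=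
    hx (h.trans (map_zero _).symm)
  rw [← hM.ofEntries_eq, ← aeval_det_ofEntries_X (R := R), hX, map_zero] at hdet
  exact hdet rfl

end GenericDeterminant

/-! ### Generic vectors and coframes -/

section Specialization

theorem map_intCast_eq_zero_of_charP {K₀ R T : Type*} [CommRing K₀] [CommRing R] (p : ℕ)
    [CharP K₀ p] [CharP R p] {q : MvPolynomial T ℤ}
    (hq : MvPolynomial.map (Int.castRingHom K₀) q = 0) :
    MvPolynomial.map (Int.castRingHom R) q = 0 := by
  ext m
  have := congrArg (MvPolynomial.coeff m) hq
  rw [MvPolynomial.coeff_map, MvPolynomial.coeff_zero] at this ⊢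
  exact (CharP.intCast_eq_zero_iff R p _).2 ((CharP.intCast_eq_zero_iff K₀ p _).1 this)

theorem ker_aeval_le_of_algebraicIndependent {K₀ F R T : Type*} [CommRing K₀] [CommRing F]
    [CommRing R] [Algebra K₀ F] (p : ℕ) [CharP K₀ p] [CharP R p] {x : T → F}
    (hx : AlgebraicIndependent K₀ x) (y : T → R) :
    RingHom.ker (MvPolynomial.aeval (R := ℤ) x).toRingHom ≤
      RingHom.ker (MvPolynomial.aeval (R := ℤ) y).toRingHom := by
  intro q (hq : MvPolynomial.aeval x q = 0)
  have hq₀ : MvPolynomial.map (Int.castRingHom K₀) q = 0 := hx (by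
    rw [map_zero, ← hq, ← algebraMap_int_eq, MvPolynomial.aeval_map_algebraMap])
  change MvPolynomial.aeval y q = 0
  rw [MvPolynomial.aeval_def, ← MvPolynomial.eval_map, algebraMap_int_eq,
    map_intCast_eq_zero_of_charP p hq₀, map_zero]

theorem exists_det_submatrix_ne_zero {K ι τ : Type*} [Field K] [Finite ι] [Fintype τ]
    [DecidableEq τ] {Z : Matrix ι τ K} (h : ∀ v, Z *ᵥ v = 0 → v = 0) :
    ∃ g : τ → ι, (Z.submatrix g id).det ≠ 0 := by
  have hrank : Module.finrank K (Submodule.span K (Set.range Z.row)) = Fintype.card τ := by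
    rw [← Matrix.rank_eq_finrank_span_row, Matrix.rank, LinearMap.finrank_range_of_inj,
      Module.finrank_fintype_fun_eq_card]
    exact (injective_iff_map_eq_zero _).2 h
  obtain ⟨f, hf, -, hli⟩ := Submodule.exists_fun_fin_finrank_span_eq K (Set.range Z.row)
  choose g hg using hf
  let E : τ ≃ Fin (Module.finrank K (Submodule.span K (Set.range Z.row))) :=
    (Fintype.equivFin τ).trans (finCongr hrank.symm)
  have hrow : (Z.submatrix (g ∘ E) id).row = f ∘ E := funext fun i => hg (E i)
  have hunit := Matrix.linearIndependent_rows_iff_isUnit.1 (hrow ▸ hli.comp E E.injective)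
  exact ⟨g ∘ E, ((Matrix.isUnit_iff_isUnit_det _).1 hunit).ne_zero⟩

variable {R F K ι τ : Type*} [CommRing R] [Field F] [Field K] [Finite ι] [Fintype τ]
  {f : R →+* F} {g : R →+* K}

theorem eq_zero_of_map_mulVec_eq_zero_of_ker_le (hfg : RingHom.ker f ≤ RingHom.ker g)
    {Z : Matrix ι τ R} (h : ∀ v, Z.map g *ᵥ v = 0 → v = 0) {v : τ → F}
    (hv : Z.map f *ᵥ v = 0) : v = 0 := by
  classical
  obtain ⟨s, hs⟩ := exists_det_submatrix_ne_zero h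
  have hf : ((Z.map f).submatrix s id).det ≠ 0 := by
    rw [Matrix.submatrix_map, ← RingHom.mapMatrix_apply, ← RingHom.map_det] at hs ⊢
    exact fun h0 => hs (hfg h0)
  exact Matrix.eq_zero_of_mulVec_eq_zero hf (funext fun i => congrFun hv (s i))

theorem ContainsNoSupport.of_ker_le (hfg : RingHom.ker f ≤ RingHom.ker g) {S : Set ι}
    {A : Matrix ι τ R} (hA : ∀ v, A.map g *ᵥ v = 0 → v = 0)
    (h : ContainsNoSupport S (Set.range (A.map g).mulVec)) :
    ContainsNoSupport S (Set.range (A.map f).mulVec) := by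
  rintro _ ⟨v, rfl⟩ hv
  rw [eq_zero_of_map_mulVec_eq_zero_of_ker_le hfg (Z := A.submatrix (Subtype.val : ↥Sᶜ → ι) id)
    (fun w hw => hA w (h _ ⟨w, rfl⟩ fun e he => congrFun hw ⟨e, he⟩)) (v := v)
    (funext fun e => hv e e.2), Matrix.mulVec_zero]

end Specialization

section ProductEntries

variable {R F K ι κ ρ τ : Type*} [CommRing R] [Field F] [Field K] {f : R →+* F} {g : R →+* K}

theorem kronecker_map {A : Type*} [CommRing A] (φ : R →+* A) (U : Matrix ι ρ R)
    (V : Matrix κ τ R) : (U ⊗ₖ V).map φ = U.map φ ⊗ₖ V.map φ := by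
  ext
  exact map_mul φ _ _

variable [Fintype ρ] [Fintype τ]

theorem productEntries_mul_subset (U : Matrix ι ρ R) (V : Matrix κ τ R) (G : Matrix ρ ρ R)
    (H : Matrix τ τ R) : productEntries (U * G) (V * H) ⊆ productEntries U V := by
  rintro _ ⟨B, rfl⟩
  exact ⟨G * B * Hᵀ, by simp only [Matrix.transpose_mul, Matrix.mul_assoc]⟩

theorem productEntries_mul [DecidableEq ρ] [DecidableEq τ] (U : Matrix ι ρ R) (V : Matrix κ τ R)
    {G : Matrix ρ ρ R} {H : Matrix τ τ R} (hG : IsUnit G.det) (hH : IsUnit H.det) :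
    productEntries (U * G) (V * H) = productEntries U V := by
  refine (productEntries_mul_subset U V G H).antisymm ?_
  have := productEntries_mul_subset (U * G) (V * H) G⁻¹ H⁻¹
  rwa [Matrix.mul_nonsing_inv_cancel_right _ _ hG, Matrix.mul_nonsing_inv_cancel_right _ _ hH]
    at this

theorem kronecker_mulVec_vec_transpose (U : Matrix ι ρ R) (V : Matrix κ τ R) (B : Matrix ρ τ R) :
    (U ⊗ₖ V) *ᵥ Bᵀ.vec = fun e => (U * B * Vᵀ) e.1 e.2 := by
  rw [Matrix.kronecker_mulVec_vec, Matrix.mul_assoc, ← Matrix.transpose_mul,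
    ← Matrix.transpose_transpose V, ← Matrix.transpose_mul, Matrix.transpose_transpose]
  rfl

theorem productEntries_eq_range_mulVec (U : Matrix ι ρ R) (V : Matrix κ τ R) :
    productEntries U V = Set.range (U ⊗ₖ V).mulVec := by
  have hvec : Function.Surjective fun B : Matrix ρ τ R => Bᵀ.vec :=
    Matrix.vec_bijective.surjective.comp fun B => ⟨Bᵀ, B.transpose_transpose⟩
  rw [← hvec.range_comp]
  exact congrArg Set.range (funext fun B => (kronecker_mulVec_vec_transpose U V B).symm)

theorem containsNoSupport_productEntries_of_ker_le [Finite ι] [Finite κ]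
    (hfg : RingHom.ker f ≤ RingHom.ker g) {S : Set (ι × κ)} {U : Matrix ι ρ R} {V : Matrix κ τ R}
    (hUV : ∀ B : Matrix ρ τ K, U.map g * B * (V.map g)ᵀ = 0 → B = 0)
    (h : ContainsNoSupport S (productEntries (U.map g) (V.map g))) :
    ContainsNoSupport S (productEntries (U.map f) (V.map f)) := by
  rw [productEntries_eq_range_mulVec, ← kronecker_map] at h ⊢
  refine .of_ker_le hfg (fun v hv => ?_) h
  obtain ⟨B, rfl⟩ := Matrix.vec_bijective.surjective v
  rw [kronecker_map, ← B.transpose_transpose, kronecker_mulVec_vec_transpose] at hv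
  have hB := hUV Bᵀ (Matrix.ext fun i j => congrFun hv (i, j))
  rw [← B.transpose_transpose, hB, Matrix.transpose_zero, Matrix.vec_zero]

end ProductEntries

section SymmetryProductEntries

variable {R F K ρ : Type*} [CommRing R] [Field F] [Field K] {s : Symmetry} {n r : ℕ}
  {f : R →+* F} {g : R →+* K}

theorem symmetryProductEntries_mul_subset [Fintype ρ] (U : Matrix (Fin n) ρ R) (G : Matrix ρ ρ R) :
    symmetryProductEntries s (U * G) ⊆ symmetryProductEntries s U := by
  rintro _ ⟨B, hB, rfl⟩
  exact ⟨G * B * Gᵀ, hB.mul_mul_transpose G, by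
    simp only [Matrix.transpose_mul, Matrix.mul_assoc]⟩

theorem symmetryProductEntries_mul [Fintype ρ] [DecidableEq ρ] (U : Matrix (Fin n) ρ R)
    {G : Matrix ρ ρ R} (hG : IsUnit G.det) :
    symmetryProductEntries s (U * G) = symmetryProductEntries s U := by
  refine (symmetryProductEntries_mul_subset U G).antisymm ?_
  have := symmetryProductEntries_mul_subset (s := s) (U * G) G⁻¹
  rwa [Matrix.mul_nonsing_inv_cancel_right _ _ hG] at this

/-- The free entries of `U * B * Uᵀ` as a linear function of those of `B`, for matrices `B` of
symmetry type `s`. -/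
def congruenceMap (s : Symmetry) (U : Matrix (Fin n) (Fin r) R) :
    (EntryIndex s r → R) →ₗ[R] (EntryIndex s n → R) where
  toFun c e := (U * ofEntries s c * Uᵀ) e.1.1 e.1.2
  map_add' c c' := by
    rw [map_add, Matrix.mul_add, Matrix.add_mul]
    rfl
  map_smul' a c := by
    rw [map_smul, Matrix.mul_smul, Matrix.smul_mul]
    rfl

theorem symmetryProductEntries_eq_range_mulVec (U : Matrix (Fin n) (Fin r) R) :
    symmetryProductEntries s U = Set.range (congruenceMap s U).toMatrix'.mulVec := by
  rw [funext (LinearMap.toMatrix'_mulVec (congruenceMap s U))]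
  apply subset_antisymm
  · rintro _ ⟨B, hB, rfl⟩
    refine ⟨fun e => B e.1.1 e.1.2, funext fun e => ?_⟩
    exact congrArg (fun B => (U * B * Uᵀ) e.1.1 e.1.2) hB.ofEntries_eq
  · rintro _ ⟨c, rfl⟩
    exact ⟨ofEntries s c, hasSymmetry_ofEntries c, rfl⟩

theorem congruenceMap_map_comp {A : Type*} [CommRing A] (φ : R →+* A)
    (U : Matrix (Fin n) (Fin r) R) (c : EntryIndex s r → R) :
    congruenceMap s (U.map φ) (φ ∘ c) = φ ∘ congruenceMap s U c := by
  ext e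
  change (U.map φ * ofEntries s (fun e => φ (c e)) * Uᵀ.map φ) e.1.1 e.1.2 = _
  rw [← ofEntries_map, ← Matrix.map_mul, ← Matrix.map_mul]
  rfl

theorem toMatrix'_congruenceMap_map {A : Type*} [CommRing A] (φ : R →+* A)
    (U : Matrix (Fin n) (Fin r) R) :
    (congruenceMap s U).toMatrix'.map φ = (congruenceMap s (U.map φ)).toMatrix' := by
  ext e t
  have hsingle : (Pi.single t 1 : EntryIndex s r → A) = φ ∘ Pi.single t 1 := by
    ext t'
    rw [Function.comp_apply, Pi.single_apply, Pi.single_apply, apply_ite φ, map_one, map_zero]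
  rw [Matrix.map_apply, LinearMap.toMatrix'_apply, LinearMap.toMatrix'_apply, hsingle,
    congruenceMap_map_comp]
  rfl

theorem eq_zero_of_congruenceMap_eq_zero {U : Matrix (Fin n) (Fin r) R}
    (hU : ∀ B : Matrix (Fin r) (Fin r) R, U * B * Uᵀ = 0 → B = 0) {c : EntryIndex s r → R}
    (hc : congruenceMap s U c = 0) : c = 0 := by
  have hB : ofEntries s c = 0 := hU _ <| by
    rw [← map_zero (ofEntries s)]
    refine ((hasSymmetry_ofEntries c).mul_mul_transpose _).ext (hasSymmetry_ofEntries 0) fun e => ?_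
    rw [ofEntries_apply]
    exact congrFun hc e
  exact funext fun e => by rw [← ofEntries_apply c, hB]; rfl

theorem containsNoSupport_symmetryProductEntries_of_ker_le (hfg : RingHom.ker f ≤ RingHom.ker g)
    {S : Set (EntryIndex s n)} {U : Matrix (Fin n) (Fin r) R}
    (hU : ∀ B : Matrix (Fin r) (Fin r) K, U.map g * B * (U.map g)ᵀ = 0 → B = 0)
    (h : ContainsNoSupport S (symmetryProductEntries s (U.map g))) :
    ContainsNoSupport S (symmetryProductEntries s (U.map f)) := by
  rw [symmetryProductEntries_eq_range_mulVec, ← toMatrix'_congruenceMap_map] at h ⊢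
  refine .of_ker_le hfg (fun c hc => eq_zero_of_congruenceMap_eq_zero hU ?_) h
  rwa [toMatrix'_congruenceMap_map, LinearMap.toMatrix'_mulVec] at hc

end SymmetryProductEntries

section Coframes

variable {R ι κ δ ε ρ τ : Type*} [CommRing R] [Fintype δ] [Fintype ε] [Fintype ρ]
  [Fintype τ] [DecidableEq ι] [DecidableEq κ]

theorem eq_zero_of_coframe_mul_mul_transpose_eq_zero (e : ι ≃ δ ⊕ ρ) (e' : κ ≃ ε ⊕ τ)
    (P : Matrix ρ δ R) (Q : Matrix τ ε R) {B : Matrix ρ τ R}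
    (h : coframe e P * B * (coframe e' Q)ᵀ = 0) : B = 0 := by
  classical
  have := Fintype.ofEquiv _ e.symm
  have := Fintype.ofEquiv _ e'.symm
  calc B = (tailInclusion R e)ᵀ * coframe e P * B *
        ((tailInclusion R e')ᵀ * coframe e' Q)ᵀ := by
        rw [tailInclusion_transpose_mul_coframe, tailInclusion_transpose_mul_coframe,
          Matrix.transpose_one, Matrix.one_mul, Matrix.mul_one]
    _ = (tailInclusion R e)ᵀ * (coframe e P * B * (coframe e' Q)ᵀ) * tailInclusion R e' := by
        simp only [Matrix.transpose_mul, Matrix.transpose_transpose, Matrix.mul_assoc]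
    _ = 0 := by rw [h, Matrix.mul_zero, Matrix.zero_mul]

end Coframes

section GenericSupport

/-- The matrix of integer polynomial variables with names `t`. -/
noncomputable def variableMatrix {ι ρ T : Type*} (t : ι × ρ → T) : Matrix ι ρ (MvPolynomial T ℤ) :=
  .of fun i a => .X (t (i, a))

theorem variableMatrix_map_aeval {ι ρ T R : Type*} [CommRing R] (t : ι × ρ → T) (x : T → R) :
    (variableMatrix t).map (MvPolynomial.aeval x).toRingHom = .of fun i a => x (t (i, a)) :=
  Matrix.ext fun _ _ => MvPolynomial.aeval_X _ _

theorem isUnit_det_tailInclusion_transpose_mul {K₀ F ι δ ρ : Type*} [CommRing K₀] [Nontrivial K₀]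
    [Field F] [Algebra K₀ F] [Fintype ι] [DecidableEq ι] [Fintype ρ] [DecidableEq ρ]
    (e : ι ≃ δ ⊕ ρ) {U : Matrix ι ρ F} (hU : AlgebraicIndependent K₀ fun x : ι × ρ => U x.1 x.2) :
    IsUnit ((tailInclusion F e)ᵀ * U).det := by
  rw [tailInclusion_transpose_mul]
  have hrows : Function.Injective (Prod.map (e.symm ∘ Sum.inr) id : ρ × ρ → ι × ρ) :=
    (e.symm.injective.comp Sum.inr_injective).prodMap Function.injective_id
  have htail := hU.comp _ hrows
  exact (det_ne_zero_of_algebraicIndependent (M := U.submatrix (e.symm ∘ Sum.inr) id) htail).isUnit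

variable {K₀ k F K ι κ δ ε ρ τ : Type*} [CommRing K₀] [CommRing k] [Field F] [Field K]
  [Algebra K₀ F] [Algebra k K] [Fintype δ] [Fintype ε] [Fintype ρ] [Fintype τ]
  [DecidableEq ι] [DecidableEq κ]

theorem ContainsNoSupport.productEntries_coframe (p : ℕ) [CharP k p] [CharP F p] (e : ι ≃ δ ⊕ ρ)
    (e' : κ ≃ ε ⊕ τ) {S : Set (ι × κ)} {P : Matrix ρ δ F} {Q : Matrix τ ε F}
    (h : ContainsNoSupport S (productEntries (coframe e P) (coframe e' Q)))
    {P' : Matrix ρ δ K} {Q' : Matrix τ ε K} (hPQ : AlgebraicIndependent k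
      (Sum.elim (fun x : ρ × δ => P' x.1 x.2) fun x : τ × ε => Q' x.1 x.2)) :
    ContainsNoSupport S (productEntries (coframe e P') (coframe e' Q')) := by
  have := Fintype.ofEquiv _ e.symm
  have := Fintype.ofEquiv _ e'.symm
  have hspecialize := containsNoSupport_productEntries_of_ker_le (S := S)
    (ker_aeval_le_of_algebraicIndependent p hPQ
      (Sum.elim (fun x : ρ × δ => P x.1 x.2) fun x => Q x.1 x.2))
    (U := coframe e (variableMatrix Sum.inl)) (V := coframe e' (variableMatrix Sum.inr))
  simp only [coframe_map, variableMatrix_map_aeval] at hspecialize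
  exact hspecialize (fun B => eq_zero_of_coframe_mul_mul_transpose_eq_zero e e' _ _) h

/-- The change of basis `tailᵀ * U` brings the generic matrix `U` into coframe form, without
changing the set of matrices `U * B * Vᵀ`. -/
theorem containsNoSupport_productEntries_iff_coframe [Nontrivial K₀] (p : ℕ) [CharP K₀ p]
    [CharP k p] [CharP F p] [CharP K p] (e : ι ≃ δ ⊕ ρ) (e' : κ ≃ ε ⊕ τ) {S : Set (ι × κ)}
    {U : Matrix ι ρ F} {V : Matrix κ τ F} (hUV : AlgebraicIndependent K₀
      (Sum.elim (fun x : ι × ρ => U x.1 x.2) fun x : κ × τ => V x.1 x.2))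
    {P : Matrix ρ δ K} {Q : Matrix τ ε K} (hPQ : AlgebraicIndependent k
      (Sum.elim (fun x : ρ × δ => P x.1 x.2) fun x : τ × ε => Q x.1 x.2)) :
    ContainsNoSupport S (productEntries U V) ↔
      ContainsNoSupport S (productEntries (coframe e P) (coframe e' Q)) := by
  classical
  have := Fintype.ofEquiv _ e.symm
  have := Fintype.ofEquiv _ e'.symm
  constructor
  · intro h
    have hG := isUnit_det_tailInclusion_transpose_mul e (hUV.comp Sum.inl Sum.inl_injective)
    have hH := isUnit_det_tailInclusion_transpose_mul e' (hUV.comp Sum.inr Sum.inr_injective)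
    obtain ⟨P', hP'⟩ := exists_eq_coframe_mul e hG
    obtain ⟨Q', hQ'⟩ := exists_eq_coframe_mul e' hH
    rw [hP', hQ', productEntries_mul _ _ hG hH] at h
    exact h.productEntries_coframe p e e' hPQ
  · intro h
    have hspecialize := containsNoSupport_productEntries_of_ker_le (S := S)
      (ker_aeval_le_of_algebraicIndependent p hUV
        (Sum.elim (fun x => coframe e P x.1 x.2) fun x => coframe e' Q x.1 x.2))
      (U := variableMatrix Sum.inl) (V := variableMatrix Sum.inr)
    simp only [variableMatrix_map_aeval] at hspecialize
    exact hspecialize (fun B => eq_zero_of_coframe_mul_mul_transpose_eq_zero e e' _ _) h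

variable {s : Symmetry} {n r : ℕ} {S : Set (EntryIndex s n)}

theorem ContainsNoSupport.symmetryProductEntries_coframe (p : ℕ) [CharP k p] [CharP F p]
    (e : Fin n ≃ δ ⊕ Fin r) {P : Matrix (Fin r) δ F}
    (h : ContainsNoSupport S (symmetryProductEntries s (coframe e P))) {P' : Matrix (Fin r) δ K}
    (hP' : AlgebraicIndependent k fun x : Fin r × δ => P' x.1 x.2) :
    ContainsNoSupport S (symmetryProductEntries s (coframe e P')) := by
  have hspecialize := containsNoSupport_symmetryProductEntries_of_ker_le (S := S)
    (ker_aeval_le_of_algebraicIndependent p hP' fun x => P x.1 x.2)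
    (U := coframe e (variableMatrix id))
  simp only [coframe_map, variableMatrix_map_aeval] at hspecialize
  exact hspecialize (fun B => eq_zero_of_coframe_mul_mul_transpose_eq_zero e e _ _) h

theorem containsNoSupport_symmetryProductEntries_iff_coframe [Nontrivial K₀] (p : ℕ) [CharP K₀ p]
    [CharP k p] [CharP F p] [CharP K p] (e : Fin n ≃ δ ⊕ Fin r) {U : Matrix (Fin n) (Fin r) F}
    (hU : AlgebraicIndependent K₀ fun x : Fin n × Fin r => U x.1 x.2)
    {P : Matrix (Fin r) δ K} (hP : AlgebraicIndependent k fun x : Fin r × δ => P x.1 x.2) :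
    ContainsNoSupport S (symmetryProductEntries s U) ↔
      ContainsNoSupport S (symmetryProductEntries s (coframe e P)) := by
  constructor
  · intro h
    have hG := isUnit_det_tailInclusion_transpose_mul e hU
    obtain ⟨P', hP'⟩ := exists_eq_coframe_mul e hG
    rw [hP', symmetryProductEntries_mul _ hG] at h
    exact h.symmetryProductEntries_coframe p e hP
  · intro h
    have hspecialize := containsNoSupport_symmetryProductEntries_of_ker_le (S := S)
      (ker_aeval_le_of_algebraicIndependent p hU fun x => coframe e P x.1 x.2)
      (U := variableMatrix id)
    simp only [variableMatrix_map_aeval] at hspecialize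
    exact hspecialize (fun B => eq_zero_of_coframe_mul_mul_transpose_eq_zero e e _ _) h

end GenericSupport

/-! ### Dual independence and separable independence -/

section ConormalSpace

theorem algebraicIndependent_algebraMap_X {k T L : Type*} [CommRing k] [CommRing L] [Algebra k L]
    [Algebra (MvPolynomial T k) L] [IsScalarTower k (MvPolynomial T k) L]
    (h : Function.Injective (algebraMap (MvPolynomial T k) L)) :
    AlgebraicIndependent k fun t : T => algebraMap (MvPolynomial T k) L (.X t) :=
  (MvPolynomial.algebraicIndependent_X T k).map'
    (f := IsScalarTower.toAlgHom k (MvPolynomial T k) L) h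

variable {K₀ k F L : Type*} [CommRing K₀] [Nontrivial K₀] [Field k] [Field F] [Field L]
  [Algebra K₀ F] [Algebra k L]

theorem containsNoSupport_productEntries_iff_conormalSpace {ι κ δ ρ τ : Type*} [Fintype ι]
    [DecidableEq ι] [Fintype κ] [DecidableEq κ] [Fintype δ] [Fintype ρ] [Fintype τ]
    [Algebra (MvPolynomial (RankParameter δ ρ τ) k) L]
    [IsScalarTower k (MvPolynomial (RankParameter δ ρ τ) k) L]
    [IsFractionRing (MvPolynomial (RankParameter δ ρ τ) k) L]
    (p : ℕ) [CharP K₀ p] [CharP k p] [CharP F p] (e : ι ≃ δ ⊕ ρ) (e' : κ ≃ δ ⊕ τ)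
    {U : Matrix ι ρ F} {V : Matrix κ τ F} (hUV : AlgebraicIndependent K₀
      (Sum.elim (fun x : ι × ρ => U x.1 x.2) fun x : κ × τ => V x.1 x.2)) {S : Set (ι × κ)} :
    ContainsNoSupport S (productEntries U V) ↔ ContainsNoSupport S (conormalSpace L
      fun x : ι × κ => rankChart e e' (MvPolynomial.X (R := k)) x.1 x.2) := by
  classical
  have := charP_of_injective_algebraMap (algebraMap k L).injective p
  have hX := algebraicIndependent_algebraMap_X (k := k) (T := RankParameter δ ρ τ)
    (IsFractionRing.injective _ L)
  have hC := hX.comp _ Sum.inl_injective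
  have hPQ := hX.comp _ Sum.inr_injective
  rw [← Sum.elim_comp_inl_inr (_ ∘ _)] at hPQ
  rw [conormalSpace_rankChart e e' (fun _ => rfl) (det_ne_zero_of_algebraicIndependent hC)]
  exact containsNoSupport_productEntries_iff_coframe p e e' hUV hPQ

theorem containsNoSupport_symmetryProductEntries_iff_conormalSpace {s : Symmetry} {n d r : ℕ}
    [Algebra (MvPolynomial (SymmetryParameter s d (Fin r)) k) L]
    [IsScalarTower k (MvPolynomial (SymmetryParameter s d (Fin r)) k) L]
    [IsFractionRing (MvPolynomial (SymmetryParameter s d (Fin r)) k) L]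
    (p : ℕ) [CharP K₀ p] [CharP k p] [CharP F p] (e : Fin n ≃ Fin d ⊕ Fin r)
    (hs : s = .symmetric → (2 : k) ≠ 0) {M : Matrix (Fin d) (Fin d) k} (hM : HasSymmetry s M)
    (hdet : M.det ≠ 0) {U : Matrix (Fin n) (Fin r) F}
    (hU : AlgebraicIndependent K₀ fun x : Fin n × Fin r => U x.1 x.2) {S : Set (EntryIndex s n)} :
    ContainsNoSupport S (symmetryProductEntries s U) ↔
      ContainsNoSupport S (conormalSpace L fun x : EntryIndex s n =>
        symmetryChart (s := s) e (MvPolynomial.X (R := k)) x.1.1 x.1.2) := by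
  have := charP_of_injective_algebraMap (algebraMap k L).injective p
  have hX := algebraicIndependent_algebraMap_X (k := k) (T := SymmetryParameter s d (Fin r))
    (IsFractionRing.injective _ L)
  have hC := hM.det_ofEntries_ne_zero_of_algebraicIndependent hdet
    (hX.comp _ Sum.inl_injective)
  have hP := hX.comp _ Sum.inr_injective
  have htwo (h : s = .symmetric) : (2 : L) ≠ 0 := by
    rw [← map_ofNat (algebraMap k L)]
    exact (map_ne_zero_iff _ (algebraMap k L).injective).2 (hs h)
  rw [containsNoSupport_conormalSpace_symmetryChart_iff htwo (fun _ => rfl) hC]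
  exact containsNoSupport_symmetryProductEntries_iff_coframe p e hU hP

end ConormalSpace

theorem charP_bot_subfield (F : Type*) [Field F] (p : ℕ) [CharP F p] :
    CharP (⊥ : Subfield F) p :=
  (⊥ : Subfield F).subtype.charP (⊥ : Subfield F).subtype.injective p

variable (k : Type*) [Field k] {F : Type*} [Field F] {m n d : ℕ}

section Tensor

variable {t r : ℕ}

theorem separablyAlgebraicallyIndependent_rankLocus_iff
    (e : Fin m ≃ Fin d ⊕ Fin t) (e' : Fin n ≃ Fin d ⊕ Fin r)
    [(matrixIdeal k (rankLocus (AlgebraicClosure k) m n d)).IsPrime] {S : Set (Fin m × Fin n)} :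
    SeparablyAlgebraicallyIndependent k
        (fun x : S => coordinateFunction k (rankLocus (AlgebraicClosure k) m n d) x.1) ↔
      ContainsNoSupport S (conormalSpace
        (FractionRing (MvPolynomial (RankParameter (Fin d) (Fin t) (Fin r)) k))
        fun x : Fin m × Fin n => rankChart e e' (MvPolynomial.X (R := k)) x.1 x.2) := by
  refine coordinateFunction_separablyAlgebraicallyIndependent_iff
    (matrixIdeal_rankLocus k e e') (adjoin_chart_eq_top ?_ ?_) id
  · exact det_ne_zero_of_algebraicIndependent (R := k)
      ((MvPolynomial.algebraicIndependent_X _ k).comp _ Sum.inl_injective)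
  · rintro (⟨i, j⟩ | ⟨i, j⟩ | ⟨i, j⟩)
    exacts [.inr (.inl ⟨i, j, rfl⟩), .inl ⟨i, j, rfl⟩, .inr (.inr ⟨i, j, rfl⟩)]

theorem isPrime_matrixIdeal_rankLocus (e : Fin m ≃ Fin d ⊕ Fin t) (e' : Fin n ≃ Fin d ⊕ Fin r) :
    (matrixIdeal k (rankLocus (AlgebraicClosure k) m n d)).IsPrime :=
  matrixIdeal_isPrime_of_eq_ker (matrixIdeal_rankLocus k e e')

theorem containsNoSupport_productEntries_iff_separablyAlgebraicallyIndependent (p : ℕ) [CharP k p]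
    [CharP F p] (e : Fin m ≃ Fin d ⊕ Fin t) (e' : Fin n ≃ Fin d ⊕ Fin r)
    [(matrixIdeal k (rankLocus (AlgebraicClosure k) m n d)).IsPrime]
    {u : Fin m → Fin t → F} {v : Fin n → Fin r → F} (huv : JointlyTotallyGeneric u v)
    {S : Set (Fin m × Fin n)} :
    ContainsNoSupport S (productEntries (Matrix.of u) (Matrix.of v)) ↔
      SeparablyAlgebraicallyIndependent k
        (fun x : S => coordinateFunction k (rankLocus (AlgebraicClosure k) m n d) x.1) := by
  have := charP_bot_subfield F p
  rw [separablyAlgebraicallyIndependent_rankLocus_iff k e e']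
  exact containsNoSupport_productEntries_iff_conormalSpace p e e' huv

end Tensor

section SymmetryType

variable {s : Symmetry} {M : Matrix (Fin d) (Fin d) k} {r : ℕ}

theorem isPrime_matrixIdeal_symmetryRankLocus (e : Fin n ≃ Fin d ⊕ Fin r) :
    (matrixIdeal k (symmetryRankLocus s (AlgebraicClosure k) n d)).IsPrime :=
  matrixIdeal_isPrime_of_eq_ker (matrixIdeal_symmetryRankLocus k e)

theorem separablyAlgebraicallyIndependent_symmetryRankLocus_iff (e : Fin n ≃ Fin d ⊕ Fin r)
    (hM : HasSymmetry s M) (hdet : M.det ≠ 0)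
    [(matrixIdeal k (symmetryRankLocus s (AlgebraicClosure k) n d)).IsPrime]
    {S : Set (EntryIndex s n)} :
    SeparablyAlgebraicallyIndependent k
        (fun x : S => coordinateFunction k (symmetryRankLocus s (AlgebraicClosure k) n d) x.1.1) ↔
      ContainsNoSupport S (conormalSpace
        (FractionRing (MvPolynomial (SymmetryParameter s d (Fin r)) k))
        fun x : EntryIndex s n =>
          symmetryChart (s := s) e (MvPolynomial.X (R := k)) x.1.1 x.1.2) := by
  classical
  refine coordinateFunction_separablyAlgebraicallyIndependent_iff
    (matrixIdeal_symmetryRankLocus k e) (adjoin_chart_eq_top ?_ ?_) Subtype.val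
  · exact hM.det_ofEntries_ne_zero_of_algebraicIndependent hdet
      ((MvPolynomial.algebraicIndependent_X _ k).comp _ Sum.inl_injective)
  · rintro (x | ⟨i, j⟩)
    exacts [.inr (.inl ⟨x.1.1, x.1.2, ofEntries_apply _ x⟩), .inl ⟨i, j, rfl⟩]

theorem containsNoSupport_symmetryProductEntries_iff_separablyAlgebraicallyIndependent (p : ℕ)
    [CharP k p] [CharP F p] (e : Fin n ≃ Fin d ⊕ Fin r) (hs : s = .symmetric → (2 : k) ≠ 0)
    (hM : HasSymmetry s M) (hdet : M.det ≠ 0)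
    [(matrixIdeal k (symmetryRankLocus s (AlgebraicClosure k) n d)).IsPrime]
    {v : Fin n → Fin r → F} (hv : TotallyGeneric v) {S : Set (EntryIndex s n)} :
    ContainsNoSupport S (symmetryProductEntries s (Matrix.of v)) ↔
      SeparablyAlgebraicallyIndependent k fun x : S =>
        coordinateFunction k (symmetryRankLocus s (AlgebraicClosure k) n d) x.1.1 := by
  classical
  have := charP_bot_subfield F p
  rw [separablyAlgebraicallyIndependent_symmetryRankLocus_iff k e hM hdet]
  exact containsNoSupport_symmetryProductEntries_iff_conormalSpace p e hs hM hdet hv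

theorem exists_alternating_det_ne_zero (R : Type*) [CommRing R] [Nontrivial R] (d : ℕ) :
    ∃ M : Matrix (Fin (2 * d)) (Fin (2 * d)) R, HasSymmetry .alternating M ∧ M.det ≠ 0 := by
  let σ : Fin (2 * d) ≃ Fin d ⊕ Fin d := (finCongr (two_mul d)).trans finSumFinEquiv.symm
  have hJ : HasSymmetry .alternating (Matrix.J (Fin d) R) := by
    refine hasSymmetry_alternating_iff.2 ⟨Matrix.J_transpose (Fin d) R, ?_⟩
    rintro (_ | _) <;> simp [Matrix.J]
  refine ⟨(Matrix.J (Fin d) R).submatrix σ σ, hJ.submatrix σ, ?_⟩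
  rw [Matrix.det_submatrix_equiv_self]
  exact (Matrix.isUnit_det_J (Fin d) R).ne_zero

theorem two_ne_zero_of_charP (R : Type*) [NonAssocRing R] [Nontrivial R] [NoZeroDivisors R] (p : ℕ)
    [CharP R p] (hp : p ≠ 2) : (2 : R) ≠ 0 :=
  Ring.two_ne_zero (by rwa [← CharP.eq (R := R) ‹_› (ringChar.charP R)])

end SymmetryType

/-- The decomposition of the indices into the first `d` and the rest. -/
def headTailEquiv (h : d ≤ n) : Fin n ≃ Fin d ⊕ Fin (n - d) :=
  (finCongr (by omega)).trans finSumFinEquiv.symm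

end LowRank

open LowRank in
theorem mainTheorem10 (p : ℕ) (k : Type*) [Field k] [CharP k p] (F : Type*) [Field F] [CharP F p] :
    (p ≠ 2 → ∀ n d : ℕ, d ≤ n →
      ∃ _ : (matrixIdeal k (symRankLocus (AlgebraicClosure k) n d)).IsPrime,
        ∀ v : Fin n → Fin (n - d) → F, TotallyGeneric v → ∀ S : Set (SymIndex n),
          (symmetricPowerMatroid v).dual.Indep S ↔
            SeparablyAlgebraicallyIndependent k (fun e : S =>
              coordinateFunction k (symRankLocus (AlgebraicClosure k) n d) e.1.1)) ∧
    (∀ n d : ℕ, 2 * d ≤ n →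
      ∃ _ : (matrixIdeal k (skewRankLocus (AlgebraicClosure k) n (2 * d))).IsPrime,
        ∀ v : Fin n → Fin (n - 2 * d) → F, TotallyGeneric v → ∀ S : Set (SkewIndex n),
          (wedgePowerMatroid v).dual.Indep S ↔
            SeparablyAlgebraicallyIndependent k (fun e : S =>
              coordinateFunction k (skewRankLocus (AlgebraicClosure k) n (2 * d)) e.1.1)) ∧
    (∀ m n d : ℕ, d ≤ m → d ≤ n →
      ∃ _ : (matrixIdeal k (rankLocus (AlgebraicClosure k) m n d)).IsPrime,
        ∀ (u : Fin m → Fin (m - d) → F) (v : Fin n → Fin (n - d) → F),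
          JointlyTotallyGeneric u v → ∀ S : Set (Fin m × Fin n),
            (tensorMatroid u v).dual.Indep S ↔
              SeparablyAlgebraicallyIndependent k (fun e : S =>
                coordinateFunction k (rankLocus (AlgebraicClosure k) m n d) e.1)) := by
  refine ⟨fun hp n d hd => ?_, fun n d hd => ?_, fun m n d hm hn => ?_⟩
  · rw [← symmetryRankLocus_symmetric]
    have hprime := isPrime_matrixIdeal_symmetryRankLocus (s := .symmetric) k (headTailEquiv hd)
    have hone : HasSymmetry .symmetric (1 : Matrix (Fin d) (Fin d) k) :=
      hasSymmetry_symmetric_iff.2 Matrix.isSymm_one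
    have hdet : (1 : Matrix (Fin d) (Fin d) k).det ≠ 0 := Matrix.det_one.trans_ne one_ne_zero
    exact ⟨hprime, fun v hv S => symmetricPowerMatroid_dual_indep_iff.trans
      (containsNoSupport_symmetryProductEntries_iff_separablyAlgebraicallyIndependent k p
        (headTailEquiv hd) (fun _ => two_ne_zero_of_charP k p hp) hone hdet hv)⟩
  · rw [← symmetryRankLocus_alternating]
    have hprime := isPrime_matrixIdeal_symmetryRankLocus (s := .alternating) k (headTailEquiv hd)
    obtain ⟨M, hM, hdet⟩ := exists_alternating_det_ne_zero k d
    exact ⟨hprime, fun v hv S => wedgePowerMatroid_dual_indep_iff.trans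
      (containsNoSupport_symmetryProductEntries_iff_separablyAlgebraicallyIndependent
        (s := .alternating) k p (headTailEquiv hd) nofun hM hdet hv)⟩
  · have hprime := isPrime_matrixIdeal_rankLocus k (headTailEquiv hm) (headTailEquiv hn)
    exact ⟨hprime, fun u v huv S => tensorMatroid_dual_indep_iff.trans
      (containsNoSupport_productEntries_iff_separablyAlgebraicallyIndependent k p
        (headTailEquiv hm) (headTailEquiv hn) huv)⟩
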